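/- Let $N\ge 1$, $\sigma\in\{1,-1\}$, let $\lambda_1,\dots,\lambda_N\in\mathbb C\setminus\{0\}$ and let $(c_{i,1},c_{i,2})\in\mathbb C^2\setminus\{0\}$ for $1\le i\le N$. Put $$z_i=\lambda_i^{-2},\qquad v_i=\frac1{4|z_i|^2},\qquad \theta_i=\theta_i(x,t)={\rm i}\Big(z_ix+\frac{t}{4z_i}\Big)\qquad(x,t\in\mathbb R),$$ and assume $\operatorname{Im}z_i<0$ for all $i$ and that the velocities are distinct, labelled so that $v_1<v_2<\cdots<v_N$. Let $M=(m_{i,j})_{1\le i,j\le N}$ with $$m_{i,j}=\frac{2z_i^*z_j}{z_j-z_i^*}\Big[\lambda_je^{\theta_i^*+\theta_j}+\lambda_i^*\gamma_{i,j}e^{-\theta_i^*-\theta_j}\Big],\qquad \gamma_{i,j}=-(c_{i,1}^*c_{j,1}+\sigma c_{i,2}^*c_{j,2}),$$ let $Y_1=(e^{\theta_1},\dots,e^{\theta_N})$, $Y_2^{[s]}=(c_{1,s}e^{-\theta_1},\dots,c_{N,s}e^{-\theta_N})$, and let the $N$-bright soliton be $$u_s[N]=-2\,\frac{\det\begin{pmatrix}M&Y_1^\dagger\\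 Y_2^{[s]}&0\end{pmatrix}}{\det M},\qquad s=1,2 .$$ For $S\subseteq\{1,\dots,N\}$ let $$C(S)=\Big[\frac{c_i^\dagger\Lambda c_j}{z_j-z_i^*}\Big]_{i,j\in S},\qquad c_i=z_i\begin{pmatrix}c_{i,1}\\c_{i,2}\end{pmatrix},\quad\Lambda=\operatorname{diag}(-1,-\sigma),\qquad \det C(\emptyset)=1,$$ and for $k\in S$ let $\widehat C_s(S;k)$ be $C(S)$ with its row of index $k$ replaced by $(c_{j,s})_{j\in S}$. Write $\Delta_k=\{1,\dots,k\}$ and $\Delta^k=\{k,\dots,N\}$. For $1\le k\le N$ define $$u^{[k]}_{s,\pm}=\hat c^{\,\pm}_{k,s}\,\frac{z_k-z_k^*}{|z_k|^2}\,\frac{e^{2\hat\theta_{k,\pm}^*}}{\lambda_ke^{2(\hat\theta_{k,\pm}^*+\hat\theta_{k,\pm})}+\lambda_k^*\delta_k^{\pm}},$$ where $$\hat\theta_{k,-}=\theta_k+\frac12\sum_{j=k+1}^N\ln\frac{z_j-z_k}{z_j^*-z_k},\qquad \hat c^{\,-}_{k,s}=\frac{\det\widehat C_s(\Delta_k;k)}{\det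 C(\Delta_{k-1})}\prod_{j=k+1}^N\frac{z_j^2}{|z_j|^2},\qquad \delta_k^-=\frac{z_k-z_k^*}{|z_k|^2}\frac{\det C(\Delta_k)}{\det C(\Delta_{k-1})},$$ $$\hat\theta_{k,+}=\theta_k+\frac12\sum_{j=1}^{k-1}\ln\frac{z_j-z_k}{z_j^*-z_k},\qquad \hat c^{\,+}_{k,s}=\frac{\det\widehat C_s(\Delta^k;k)}{\det C(\Delta^{k+1})}\prod_{j=1}^{k-1}\frac{z_j^2}{|z_j|^2},\qquad \delta_k^+=\frac{z_k-z_k^*}{|z_k|^2}\frac{\det C(\Delta^k)}{\det C(\Delta^{k+1})}.$$ Let $c=\min_i|\operatorname{Im}z_i|\cdot\min_{i\ne j}|v_i-v_j|$ (if $N=1$, where the second minimum is over the empty set, $c$ may be any real number). (a) If $\sigma=-1$, assume in addition that $\det C(\Delta_k)\neq0$ for $1\le k\le N$. Then the determinants $\det C(\Delta_{k-1})$ and the denominators of the $u^{[k]}_{s,-}$ (for all $x,t$) do not vanish, and, as $t\to-\infty$, uniformly in $x\in\mathbb R$ and for $s=1,2$, $$u_s[N]=\sum_{k=1}^Nu^{[k]}_{s,-}+O(e^{-c|t|}),$$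 where $\det M\ne0$ for all $x\in\mathbb R$ once $-t$ is large enough. (b) If $\sigma=-1$, assume in addition that $\det C(\Delta^k)\neq0$ for $1\le k\le N$. Then the determinants $\det C(\Delta^{k+1})$ and the denominators of the $u^{[k]}_{s,+}$ (for all $x,t$) do not vanish, and, as $t\to+\infty$, uniformly in $x\in\mathbb R$ and for $s=1,2$, $$u_s[N]=\sum_{k=1}^Nu^{[k]}_{s,+}+O(e^{-c|t|}),$$ where $\det M\ne0$ for all $x\in\mathbb R$ once $t$ is large enough. -/

import Mathlib

open Filter
open scoped ComplexConjugate

namespace CoupledFL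

noncomputable section

/-- The parameter `z = 1/λ²` attached to each spectral parameter `λ`. -/
def zpar {N : ℕ} (lam : Fin N → ℂ) (i : Fin N) : ℂ := 1 / (lam i) ^ 2

/-- The velocities `v_i = 1/(4|z_i|²)`. -/
def vel {N : ℕ} (lam : Fin N → ℂ) (i : Fin N) : ℝ := 1 / (4 * ‖zpar lam i‖ ^ 2)

/-- The phases `θ_i = i (z_i x + t/(4 z_i))`. -/
def theta {N : ℕ} (lam : Fin N → ℂ) (i : Fin N) (x t : ℝ) : ℂ :=
  Complex.I * (zpar lam i * (x : ℂ) + (t : ℂ) / (4 * zpar lam i))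

/-- `γ_{i,j} = -(c_{i,1}^* c_{j,1} + σ c_{i,2}^* c_{j,2})`. -/
def gam {N : ℕ} (σ : ℝ) (c : Fin N → Fin 2 → ℂ) (i j : Fin N) : ℂ :=
  -(conj (c i 0) * c j 0 + (σ : ℂ) * (conj (c i 1) * c j 1))

/-- The `N × N` matrix `M = (m_{i,j})` of the `N`-fold Darboux transformation of the zero seed. -/
def matM {N : ℕ} (σ : ℝ) (lam : Fin N → ℂ) (c : Fin N → Fin 2 → ℂ) (x t : ℝ) :
    Matrix (Fin N) (Fin N) ℂ :=
  Matrix.of fun i j =>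
    2 * conj (zpar lam i) * zpar lam j / (zpar lam j - conj (zpar lam i)) *
      (lam j * Complex.exp (conj (theta lam i x t) + theta lam j x t)
        + conj (lam i) * gam σ c i j *
            Complex.exp (-conj (theta lam i x t) - theta lam j x t))

/-- The row `Y₁ = (e^{θ_1}, …, e^{θ_N})`. -/
def rowY1 {N : ℕ} (lam : Fin N → ℂ) (x t : ℝ) : Matrix Unit (Fin N) ℂ :=
  Matrix.of fun _ j => Complex.exp (theta lam j x t)

/-- The `s`-th row `Y₂^{[s]} = (c_{1,s} e^{-θ_1}, …, c_{N,s} e^{-θ_N})` of `Y₂`. -/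
def rowY2 {N : ℕ} (lam : Fin N → ℂ) (c : Fin N → Fin 2 → ℂ) (s : Fin 2) (x t : ℝ) :
    Matrix Unit (Fin N) ℂ :=
  Matrix.of fun _ j => c j s * Complex.exp (-theta lam j x t)

/-- The `s`-th component `u_s[N]` of the `N`-bright soliton. -/
def brightSoliton {N : ℕ} (σ : ℝ) (lam : Fin N → ℂ) (c : Fin N → Fin 2 → ℂ) (s : Fin 2)
    (x t : ℝ) : ℂ :=
  -2 * ((Matrix.fromBlocks (matM σ lam c x t) (rowY1 lam x t).conjTranspose
          (rowY2 lam c s x t) (0 : Matrix Unit Unit ℂ)).det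
        / (matM σ lam c x t).det)

/-- The entry `c_i† Λ c_j / (z_j - z_i^*)` of the generalized Cauchy matrices, where
`c_i = z_i (c_{i,1}, c_{i,2})ᵀ` and `Λ = diag(-1, -σ)`. -/
def cauchyEntry {N : ℕ} (σ : ℝ) (lam : Fin N → ℂ) (c : Fin N → Fin 2 → ℂ) (i j : Fin N) : ℂ :=
  (star (zpar lam i • c i) ⬝ᵥ
      ((Matrix.diagonal ![(-1 : ℂ), -(σ : ℂ)]).mulVec (zpar lam j • c j)))
    / (zpar lam j - conj (zpar lam i))

/-- The generalized Cauchy matrix with rows and columns indexed by `S`. Here `C(Δ_k)` is the case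
`S = {1, …, k}` and `C(Δ^k)` is the case `S = {k, …, N}`; for `S = ∅` the determinant is `1`. -/
def cauchyMat {N : ℕ} (σ : ℝ) (lam : Fin N → ℂ) (c : Fin N → Fin 2 → ℂ) (S : Finset (Fin N)) :
    Matrix S S ℂ :=
  Matrix.of fun i j => cauchyEntry σ lam c i j

/-- The generalized Cauchy matrix over `S` with the row of index `k` replaced by the numbers
`c_{j,s}`. For `S = {1, …, k}` the replaced row is the last one and this is `Ĉ_s(Δ_k)`; for
`S = {k, …, N}` it is the first one and this is `Ĉ_s(Δ^k)`. -/
def cauchyHat {N : ℕ} (σ : ℝ) (lam : Fin N → ℂ) (c : Fin N → Fin 2 → ℂ) (s : Fin 2)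
    (S : Finset (Fin N)) (k : Fin N) : Matrix S S ℂ :=
  Matrix.of fun i j => if (i : Fin N) = k then c j s else cauchyEntry σ lam c i j

/-- The shifted phase `θ_k + ½ ∑_{j ∈ P} ln ((z_j - z_k)/(z_j^* - z_k))`. -/
def thetaHat {N : ℕ} (lam : Fin N → ℂ) (P : Finset (Fin N)) (k : Fin N) (x t : ℝ) : ℂ :=
  theta lam k x t + 1 / 2 * ∑ j ∈ P,
    Complex.log ((zpar lam j - zpar lam k) / (conj (zpar lam j) - zpar lam k))

/-- The amplitude `ĉ_{k,s}`: `S` is the set on which the bordered determinant lives, `S₀` is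
`S` without `k`, and `P` is the complement of `S`. -/
def cHat {N : ℕ} (σ : ℝ) (lam : Fin N → ℂ) (c : Fin N → Fin 2 → ℂ) (s : Fin 2)
    (S S₀ P : Finset (Fin N)) (k : Fin N) : ℂ :=
  (cauchyHat σ lam c s S k).det / (cauchyMat σ lam c S₀).det *
    ∏ j ∈ P, (zpar lam j) ^ 2 / ((‖zpar lam j‖ ^ 2 : ℝ) : ℂ)

/-- The factor `(z_k - z_k^*)/|z_k|²`. -/
def zfac {N : ℕ} (lam : Fin N → ℂ) (k : Fin N) : ℂ :=
  (zpar lam k - conj (zpar lam k)) / ((‖zpar lam k‖ ^ 2 : ℝ) : ℂ)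

/-- The constant `δ_k = (z_k - z_k^*)/|z_k|² · det C(S) / det C(S₀)`. -/
def deltaC {N : ℕ} (σ : ℝ) (lam : Fin N → ℂ) (c : Fin N → Fin 2 → ℂ)
    (S S₀ : Finset (Fin N)) (k : Fin N) : ℂ :=
  zfac lam k * ((cauchyMat σ lam c S).det / (cauchyMat σ lam c S₀).det)

/-- The denominator `λ e^{2(θ^* + θ)} + λ^* δ` of a single bright soliton. -/
def solDenom (l δ θ : ℂ) : ℂ := l * Complex.exp (2 * (conj θ + θ)) + conj l * δ

/-- The denominator of `u_{s,-}^{[k]}`. -/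
def denomMinus {N : ℕ} (σ : ℝ) (lam : Fin N → ℂ) (c : Fin N → Fin 2 → ℂ)
    (k : Fin N) (x t : ℝ) : ℂ :=
  solDenom (lam k) (deltaC σ lam c (Finset.Iic k) (Finset.Iio k) k)
    (thetaHat lam (Finset.Ioi k) k x t)

/-- The denominator of `u_{s,+}^{[k]}`. -/
def denomPlus {N : ℕ} (σ : ℝ) (lam : Fin N → ℂ) (c : Fin N → Fin 2 → ℂ)
    (k : Fin N) (x t : ℝ) : ℂ :=
  solDenom (lam k) (deltaC σ lam c (Finset.Ici k) (Finset.Ioi k) k)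
    (thetaHat lam (Finset.Iio k) k x t)

/-- The single bright soliton `u_{s,-}^{[k]}` seen as `t → -∞`. -/
def solitonMinus {N : ℕ} (σ : ℝ) (lam : Fin N → ℂ) (c : Fin N → Fin 2 → ℂ) (s : Fin 2)
    (k : Fin N) (x t : ℝ) : ℂ :=
  cHat σ lam c s (Finset.Iic k) (Finset.Iio k) (Finset.Ioi k) k * zfac lam k *
    (Complex.exp (2 * conj (thetaHat lam (Finset.Ioi k) k x t)) / denomMinus σ lam c k x t)

/-- The single bright soliton `u_{s,+}^{[k]}` seen as `t → +∞`. -/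
def solitonPlus {N : ℕ} (σ : ℝ) (lam : Fin N → ℂ) (c : Fin N → Fin 2 → ℂ) (s : Fin 2)
    (k : Fin N) (x t : ℝ) : ℂ :=
  cHat σ lam c s (Finset.Ici k) (Finset.Ioi k) (Finset.Iio k) k * zfac lam k *
    (Complex.exp (2 * conj (thetaHat lam (Finset.Iio k) k x t)) / denomPlus σ lam c k x t)

/-- The rate `min_i |Im z_i| · min_{i ≠ j} |v_i - v_j|` (both minima are over finite sets, which
are nonempty as soon as `2 ≤ N`). -/
def decayRate {N : ℕ} (lam : Fin N → ℂ) : ℝ :=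
  (⨅ i : Fin N, |(zpar lam i).im|) *
    ⨅ p : {p : Fin N × Fin N // p.1 ≠ p.2}, |vel lam p.1.1 - vel lam p.1.2|

end

end CoupledFL

/-! Multiplying row and column `i` of `M` by a real `r_i`, with the matching change of the border,
leaves `u_s[N]` unchanged. So `e^{θ_i}`, `e^{-θ_i}` may be replaced by amplitudes `p_i`, `q_i` the
larger of which has modulus `1` and the smaller `e^{-2|Re θ_i|}`. The soliton is then a quotient of
smooth functions on a bounded set (`brightSoliton_eq_amp`).

Since `Re θ_i = -Im z_i (x - v_i t)` and the points `x - v_i t` are mutually separated by a multiple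
of `|t|`, for every `x` all indices but one, `k`, have their smaller amplitude bounded by
`e^{-c|t|}` (`exists_dominant_index`). Setting these amplitudes to zero gives a point of a compact
set. There the quotient is Lipschitz, once its denominator is known not to vanish
(`exists_norm_div_sub_div_le`). This makes the estimate uniform in `x` without dividing the line
into zones.

At a truncated point `M` couples the two groups of remaining indices only through `k`. Elimination
leaves one scalar equation (`block_solve`), whose solution is exactly the `k`-th single soliton
(`ampMat_truncated`): one group contributes Cauchy products, hence the phase shift, and the other
contributes ratios of `det C`, hence `δ_k` and the polarization. The remaining single solitons are
themselves `O(e^{-2|Re θ_i|})` at `x` (`exists_norm_partSoliton_le`).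

Denominators are nonzero because `δ_k` is real, `C` being anti-Hermitian, and `Im λ_k² ≠ 0`. For `σ
= 1` the determinants of `C` are nonzero by `gramCauchy_injective`. -/

namespace CoupledFL

/-! ### Cauchy systems and elimination -/

/-- A generalized Cauchy matrix `⟨b_i, b_j⟩ / (z_j - z_i^*)` with distinct `z_i` in the lower half
plane and nonzero `b_i` has trivial kernel. -/
theorem gramCauchy_injective {ι κ : Type*} [DecidableEq ι] [Fintype κ] (T : Finset ι) (z : ι → ℂ)
    (b : ι → κ → ℂ) (hz : ∀ i, (z i).im < 0) (hinj : Function.Injective z)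
    (hb : ∀ i ∈ T, b i ≠ 0) (v : ι → ℂ)
    (hv : ∀ i ∈ T, ∑ j ∈ T, (∑ s, conj (b i s) * b j s) / (z j - conj (z i)) * v j = 0) :
    ∀ j ∈ T, v j = 0 := by
  have hne : ∀ i j, z j - conj (z i) ≠ 0 := by
    intro i j h
    have := congrArg Complex.im h
    simp at this
    linarith [hz i, hz j]
  set A : ι → ι → ℂ := fun i j => (∑ s, conj (b i s) * b j s) / (z j - conj (z i)) with hA
  have hconj : ∀ i j, conj (A j i) = -A i j := by
    intro i j
    simp only [hA, map_div₀, map_sum, map_mul, Complex.conj_conj, map_sub]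
    rw [← neg_sub (z j), div_neg]
    congr 2
    exact Finset.sum_congr rfl fun s _ => mul_comm _ _
  have hmul : ∀ i j, (z j - conj (z i)) * A i j = ∑ s, conj (b i s) * b j s := by
    intro i j
    simp only [hA]
    field_simp [hne i j]
  have hrow : ∀ v : ι → ℂ, ∀ i, ∑ j ∈ T, (z j - conj (z i)) * A i j * v j
      = ∑ s, conj (b i s) * ∑ j ∈ T, b j s * v j := by
    intro v i
    simp_rw [hmul, Finset.sum_mul, Finset.mul_sum]
    rw [Finset.sum_comm]
    simp_rw [mul_assoc]
  -- `A` is anti-Hermitian, so `Av = 0` also gives `v*A = 0`. With `Z = diag(z_j)`, the form `v*(AZ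
  -- - Z*A)v = ‖∑ b_j v_j‖²` then vanishes.
  have hker : ∀ v : ι → ℂ, (∀ i ∈ T, ∑ j ∈ T, A i j * v j = 0) →
      ∀ s, ∑ j ∈ T, b j s * v j = 0 := by
    intro v hv
    have h1 : ∀ j ∈ T, ∑ i ∈ T, conj (v i) * A i j = 0 := by
      intro j hj
      have := congrArg conj (hv j hj)
      simp only [map_sum, map_mul, hconj, map_zero] at this
      rw [← neg_eq_zero, ← Finset.sum_neg_distrib, ← this]
      exact Finset.sum_congr rfl fun i _ => by ring
    have h2 : ∑ i ∈ T, conj (v i) * ∑ j ∈ T, (z j - conj (z i)) * A i j * v j = 0 := by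
      have e1 : ∑ i ∈ T, conj (v i) * ∑ j ∈ T, z j * A i j * v j = 0 := by
        simp_rw [Finset.mul_sum]
        rw [Finset.sum_comm]
        refine Finset.sum_eq_zero fun j hj => ?_
        calc ∑ i ∈ T, conj (v i) * (z j * A i j * v j)
            = z j * v j * ∑ i ∈ T, conj (v i) * A i j := by
              rw [Finset.mul_sum]
              exact Finset.sum_congr rfl fun i _ => by ring
          _ = 0 := by rw [h1 j hj, mul_zero]
      rw [← e1]
      refine Finset.sum_congr rfl fun i hi => ?_
      congr 1
      have : conj (z i) * ∑ j ∈ T, A i j * v j = 0 := by rw [hv i hi, mul_zero]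
      rw [← sub_eq_zero, ← Finset.sum_sub_distrib, ← neg_eq_zero, ← this, Finset.mul_sum,
        ← Finset.sum_neg_distrib]
      exact Finset.sum_congr rfl fun j _ => by ring
    simp_rw [hrow, Finset.mul_sum] at h2
    rw [Finset.sum_comm] at h2
    have h3 : ∑ s, ((Complex.normSq (∑ j ∈ T, b j s * v j) : ℝ) : ℂ) = 0 := by
      rw [← h2]
      refine Finset.sum_congr rfl fun s _ => ?_
      rw [Complex.normSq_eq_conj_mul_self, map_sum, Finset.sum_mul]
      refine Finset.sum_congr rfl fun i _ => ?_
      rw [map_mul, Finset.mul_sum]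
      exact Finset.sum_congr rfl fun j _ => by ring
    rw [← Complex.ofReal_sum, Complex.ofReal_eq_zero,
      Finset.sum_eq_zero_iff_of_nonneg fun _ _ => Complex.normSq_nonneg _] at h3
    exact fun s => Complex.normSq_eq_zero.1 (h3 s (Finset.mem_univ s))
  -- The Gram matrix `AZ - Z*A` kills `v` by `hker`, so `AZv = Z*Av = 0`: the kernel is stable under
  -- `Z`, hence under polynomials in `Z`. The polynomial vanishing at every node except `z_j` will
  -- isolate `b_j v_j`.
  have hpoly : ∀ U : Finset ι, ∀ i ∈ T,
      ∑ j ∈ T, A i j * ((∏ l ∈ U, (z j - z l)) * v j) = 0 := by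
    intro U
    induction U using Finset.induction_on with
    | empty => simpa using hv
    | insert l U hl ih =>
      intro i hi
      have h1 := hrow (fun j => (∏ l ∈ U, (z j - z l)) * v j) i
      simp only [hker _ ih, mul_zero, Finset.sum_const_zero] at h1
      have h2 := ih i hi
      simp_rw [Finset.prod_insert hl]
      have h3 : (conj (z i) - z l) *
          ∑ j ∈ T, A i j * ((∏ l ∈ U, (z j - z l)) * v j) = 0 := by rw [h2, mul_zero]
      refine Eq.trans ?_ ((congrArg₂ (· + ·) h1 h3).trans (add_zero 0))
      rw [Finset.mul_sum, ← Finset.sum_add_distrib]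
      exact Finset.sum_congr rfl fun j _ => by ring
  intro j hj
  obtain ⟨s, hs⟩ := Function.ne_iff.1 (hb j hj)
  have h := hker _ (hpoly (T.erase j)) s
  rw [Finset.sum_eq_single_of_mem j hj] at h
  · have h0 : ∏ l ∈ T.erase j, (z j - z l) ≠ 0 :=
      Finset.prod_ne_zero_iff.2 fun l hl =>
        sub_ne_zero.2 fun e => (Finset.ne_of_mem_erase hl) (hinj e).symm
    simpa [h0, show b j s ≠ 0 from hs] using h
  · intro l hl hlj
    rw [Finset.prod_eq_zero (Finset.mem_erase.2 ⟨hlj, hl⟩) (sub_self _)]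
    ring

/-- The solution of a Cauchy system, evaluated at a further row. -/
theorem cauchy_interpolation {ι : Type*} [DecidableEq ι] (P : Finset ι) (z y : ι → ℂ) (a w : ℂ)
    (h : ι → ℂ) (hy : Set.InjOn y P) (hzy : ∀ i ∈ P, ∀ j ∈ P, z j - y i ≠ 0)
    (ha : ∀ i ∈ P, y i - a ≠ 0) (hw : ∀ j ∈ P, z j - w ≠ 0)
    (hsol : ∀ i ∈ P, ∑ j ∈ P, (a - y i) / (z j - y i) * h j = 1) :
    1 - ∑ j ∈ P, (a - w) / (z j - w) * h j
      = ∏ j ∈ P, (z j - a) * (y j - w) / ((y j - a) * (z j - w)) := by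
  -- `F` is the left side with its denominators cleared. By the system it vanishes at every `y_i`,
  -- and at `a` the sum disappears. `G` has the same `|P| + 1` values, which determine a polynomial
  -- of degree at most `|P|`.
  open Polynomial in
  set F : ℂ[X] := ∏ j ∈ P, (C (z j) - X)
    - ∑ j ∈ P, C (h j) * ((C a - X) * ∏ l ∈ P.erase j, (C (z l) - X)) with hF
  set G : ℂ[X] := C (∏ j ∈ P, (z j - a) / (y j - a)) * ∏ j ∈ P, (C (y j) - X) with hG
  have hlin : ∀ x : ℂ, (C x - X : ℂ[X]).natDegree ≤ 1 := fun x =>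
    (natDegree_sub_le _ _).trans (by simp)
  have hprod : ∀ (y : ι → ℂ) (Q : Finset ι), (∏ j ∈ Q, (C (y j) - X) : ℂ[X]).natDegree ≤ Q.card := by
    intro y Q
    refine (natDegree_prod_le _ _).trans ((Finset.sum_le_card_nsmul _ _ 1 fun j _ => hlin _).trans ?_)
    simp
  have hdeg : (F - G).natDegree ≤ P.card := by
    refine (natDegree_sub_le _ _).trans (max_le ((natDegree_sub_le _ _).trans (max_le (hprod _ _) ?_))
      ((natDegree_C_mul_le _ _).trans (hprod _ _)))
    refine natDegree_sum_le_of_forall_le _ _ fun j hj => ?_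
    refine (natDegree_C_mul_le _ _).trans (natDegree_mul_le.trans ?_)
    have h1 := hprod z (P.erase j)
    have h2 := hlin a
    have h3 := Finset.card_erase_add_one hj
    omega
  have hFe : ∀ x, (∀ j ∈ P, z j - x ≠ 0) → F.eval x
      = (∏ j ∈ P, (z j - x)) * (1 - ∑ j ∈ P, (a - x) / (z j - x) * h j) := by
    intro x hx
    simp only [hF, eval_sub, eval_prod, eval_finsetSum, eval_mul, eval_C, eval_X]
    rw [mul_sub, mul_one, Finset.mul_sum]
    congr 1
    refine Finset.sum_congr rfl fun j hj => ?_
    rw [← Finset.mul_prod_erase _ _ hj]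
    field_simp [hx j hj]
  have hGe : ∀ x, G.eval x = (∏ j ∈ P, (z j - a) / (y j - a)) * ∏ j ∈ P, (y j - x) := by
    intro x
    simp [hG, eval_prod]
  have hFG : F = G := by
    refine eq_of_degree_sub_lt_of_eval_finset_eq (insert a (P.image y)) ?_ ?_
    · rw [Finset.card_insert_of_notMem, Finset.card_image_of_injOn hy]
      · exact degree_le_natDegree.trans_lt (by exact_mod_cast Nat.lt_succ_of_le hdeg)
      · intro hmem
        obtain ⟨i, hi, e⟩ := Finset.mem_image.1 hmem
        exact ha i hi (sub_eq_zero.2 e)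
    · intro x hx
      rcases Finset.mem_insert.1 hx with rfl | hx
      · rw [hGe, ← Finset.prod_mul_distrib]
        simp only [hF, eval_sub, eval_prod, eval_finsetSum, eval_mul, eval_C, eval_X, sub_self,
          zero_mul, mul_zero, Finset.sum_const_zero, sub_zero]
        exact Finset.prod_congr rfl fun j hj => (div_mul_cancel₀ _ (ha j hj)).symm
      · obtain ⟨i, hi, rfl⟩ := Finset.mem_image.1 hx
        rw [hFe _ (hzy i hi), hsol i hi, hGe,
          Finset.prod_eq_zero (f := fun j => y j - y i) hi (sub_self (y i)), sub_self, mul_zero, mul_zero]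
  have h1 := hFe w hw
  rw [hFG, hGe] at h1
  rw [Finset.prod_div_distrib, Finset.prod_mul_distrib, Finset.prod_mul_distrib]
  have hA : ∏ j ∈ P, (y j - a) ≠ 0 := Finset.prod_ne_zero_iff.2 ha
  have hB : ∏ j ∈ P, (z j - w) ≠ 0 := Finset.prod_ne_zero_iff.2 hw
  rw [eq_div_iff (mul_ne_zero hA hB)]
  rw [Finset.prod_div_distrib, div_mul_eq_mul_div, div_eq_iff hA] at h1
  rw [h1]
  ring

/-- Schur complement formula for the matrix obtained by adding one index. -/
theorem det_insert_eq {ι : Type*} [DecidableEq ι] (A : ι → ι → ℂ) (T : Finset ι) (k : ι)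
    (hk : k ∉ T) (hT : (Matrix.of fun i j : T => A i j).det ≠ 0) (f : ι → ℂ)
    (hf : ∀ i ∈ T, ∑ j ∈ T, A i j * f j = A i k) :
    (Matrix.of fun i j : (insert k T : Finset ι) => A i j).det
      = (Matrix.of fun i j : T => A i j).det * (A k k - ∑ j ∈ T, A k j * f j) := by
  set B : Matrix T T ℂ := Matrix.of fun i j : T => A i j with hB
  let e : (insert k T : Finset ι) ≃ T ⊕ Unit :=
    (Finset.subtypeInsertEquivOption hk).trans (Equiv.optionEquivSumPUnit _)
  have he1 : ∀ i : T, ((e.symm (Sum.inl i) : (insert k T : Finset ι)) : ι) = i := by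
    intro i
    simp [e, Finset.subtypeInsertEquivOption]
  have he2 : ∀ u : Unit, ((e.symm (Sum.inr u) : (insert k T : Finset ι)) : ι) = k := by
    intro u
    simp [e, Finset.subtypeInsertEquivOption]
  let _ : Invertible B := B.invertibleOfIsUnitDet (isUnit_iff_ne_zero.2 hT)
  have hsub : (Matrix.of fun i j : (insert k T : Finset ι) => A i j).submatrix e.symm e.symm
      = Matrix.fromBlocks B (Matrix.of fun (i : T) (_ : Unit) => A i k)
          (Matrix.of fun (_ : Unit) (j : T) => A k j) (Matrix.of fun _ _ => A k k) := by
    ext i j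
    rcases i with i | i <;> rcases j with j | j <;> simp [he1, he2, hB]
  rw [← Matrix.det_submatrix_equiv_self e.symm, hsub, Matrix.det_fromBlocks₁₁]
  have hBf : (Matrix.of fun (i : T) (_ : Unit) => A i k)
      = B * Matrix.of fun (j : T) (_ : Unit) => f j := by
    ext i u
    rw [Matrix.mul_apply]
    simp only [hB, Matrix.of_apply]
    rw [Finset.sum_coe_sort T fun j => A i j * f j, hf i i.2]
  rw [hBf, Matrix.mul_assoc, Matrix.invOf_mul_cancel_left]
  congr 1
  rw [Matrix.det_unique]
  simp only [Matrix.sub_apply, Matrix.of_apply, Matrix.mul_apply]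
  rw [Finset.sum_coe_sort T fun j => A k j * f j]

/-- Trades determinants over a subtype for sums over `T` of functions on all of `ι`, so that one
vector can serve several index blocks at once. -/
theorem sum_eq_zero_imp_of_det_ne_zero {ι : Type*} [DecidableEq ι] (A : ι → ι → ℂ) (T : Finset ι)
    (hT : (Matrix.of fun i j : T => A i j).det ≠ 0) (v : ι → ℂ)
    (hv : ∀ i ∈ T, ∑ j ∈ T, A i j * v j = 0) : ∀ j ∈ T, v j = 0 := by
  have h := Matrix.eq_zero_of_mulVec_eq_zero hT (v := fun j : T => v j) (by
    ext i
    simp only [Matrix.mulVec, dotProduct, Matrix.of_apply, Pi.zero_apply]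
    rw [Finset.sum_coe_sort T fun j => A i j * v j, hv i i.2])
  exact fun j hj => congrFun h ⟨j, hj⟩

theorem det_ne_zero_of_sum_eq_zero_imp {ι : Type*} [DecidableEq ι] (A : ι → ι → ℂ) (T : Finset ι)
    (h : ∀ v : ι → ℂ, (∀ i ∈ T, ∑ j ∈ T, A i j * v j = 0) → ∀ j ∈ T, v j = 0) :
    (Matrix.of fun i j : T => A i j).det ≠ 0 := by
  intro h0
  obtain ⟨v, hv0, hv⟩ := Matrix.exists_mulVec_eq_zero_iff.2 h0
  refine hv0 (funext fun j => ?_)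
  have hx := h (fun j => if hj : j ∈ T then v ⟨j, hj⟩ else 0) (fun i hi => by
    rw [← Finset.sum_coe_sort T]
    simpa [Matrix.mulVec, dotProduct] using congrFun hv ⟨i, hi⟩) j j.2
  simpa using hx

theorem exists_sum_eq_of_det_ne_zero {ι : Type*} [DecidableEq ι] (A : ι → ι → ℂ) (T : Finset ι)
    (hT : (Matrix.of fun i j : T => A i j).det ≠ 0) (b : ι → ℂ) :
    ∃ v : ι → ℂ, ∀ i ∈ T, ∑ j ∈ T, A i j * v j = b i := by
  set B : Matrix T T ℂ := Matrix.of fun i j : T => A i j with hB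
  let w : T → ℂ := B⁻¹.mulVec fun i => b i
  have hw : B.mulVec w = fun i : T => b i := by
    simp only [w]
    rw [Matrix.mulVec_mulVec, Matrix.mul_nonsing_inv _ (isUnit_iff_ne_zero.2 hT), Matrix.one_mulVec]
  refine ⟨fun j => if hj : j ∈ T then w ⟨j, hj⟩ else 0, fun i hi => ?_⟩
  rw [← Finset.sum_coe_sort T]
  simpa [Matrix.mulVec, dotProduct, hB] using congrFun hw ⟨i, hi⟩

theorem sum_partition {ι : Type*} [Fintype ι] [DecidableEq ι] {S₀ P : Finset ι} {k : ι}
    (hk₀ : k ∉ S₀) (hkP : k ∉ P) (hd : Disjoint S₀ P) (hu : ∀ i, i ∈ S₀ ∨ i = k ∨ i ∈ P)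
    (f : ι → ℂ) : ∑ i, f i = ∑ i ∈ S₀, f i + f k + ∑ i ∈ P, f i := by
  have h : (Finset.univ : Finset ι) = insert k (S₀ ∪ P) := by
    ext i
    simp only [Finset.mem_univ, Finset.mem_insert, Finset.mem_union, true_iff]
    rcases hu i with h | h | h <;> simp [h]
  rw [h, Finset.sum_insert (by simp [hk₀, hkP]), Finset.sum_union hd]
  ring

/-- Elimination in a system whose matrix couples the blocks `S₀` and `P` only through `k`. -/
theorem block_solve {ι : Type*} [Fintype ι] [DecidableEq ι] {S₀ P : Finset ι} {k : ι}
    (hk₀ : k ∉ S₀) (hkP : k ∉ P) (hd : Disjoint S₀ P) (hu : ∀ i, i ∈ S₀ ∨ i = k ∨ i ∈ P)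
    (A B : ι → ι → ℂ) (f g e p q w : ι → ℂ) (η : ℂ)
    (hp₀ : ∀ i ∈ S₀, p i = 0) (hqP : ∀ i ∈ P, q i = 0) (hp : ∀ i ∈ P, p i ≠ 0)
    (hq : ∀ i ∈ S₀, q i ≠ 0)
    (hB : ∀ v : ι → ℂ, (∀ i ∈ S₀, ∑ j ∈ S₀, B i j * v j = 0) → ∀ j ∈ S₀, v j = 0)
    (hA : ∀ v : ι → ℂ, (∀ i ∈ P, ∑ j ∈ P, A i j * v j = 0) → ∀ j ∈ P, v j = 0)
    (hf : ∀ i ∈ S₀, ∑ j ∈ S₀, B i j * f j = B i k)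
    (hg : ∀ i ∈ P, ∑ j ∈ P, A i j * g j = 1)
    (he : ∀ i ∈ P, ∑ j ∈ P, A i j * e j = A i k)
    (hw : ∀ i, ∑ j, (A i j * (conj (p i) * p j) + B i j * (conj (q i) * q j)) * w j
      = η * conj (p i)) :
    (∀ j ∈ S₀, q j * w j = -(f j * (q k * w k))) ∧
    (∀ j ∈ P, p j * w j = η * g j - e j * (p k * w k)) ∧
    (conj (p k) * p k * (A k k - ∑ j ∈ P, A k j * e j)
        + conj (q k) * q k * (B k k - ∑ j ∈ S₀, B k j * f j)) * w k
      = η * conj (p k) * (1 - ∑ j ∈ P, A k j * g j) := by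
  -- The zeros of `p` and `q` leave only `S₀ ∪ {k}` in the `B` sum and only `P ∪ {k}` in the `A`
  -- sum.
  have hw' : ∀ i, conj (q i) * (∑ j ∈ S₀, B i j * (q j * w j) + B i k * (q k * w k))
      + conj (p i) * (∑ j ∈ P, A i j * (p j * w j) + A i k * (p k * w k)) = η * conj (p i) := by
    intro i
    rw [← hw i, sum_partition hk₀ hkP hd hu, mul_add, mul_add, Finset.mul_sum, Finset.mul_sum]
    have h1 : ∀ j ∈ S₀, (A i j * (conj (p i) * p j) + B i j * (conj (q i) * q j)) * w j
        = conj (q i) * (B i j * (q j * w j)) := fun j hj => by rw [hp₀ j hj]; ring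
    have h2 : ∀ j ∈ P, (A i j * (conj (p i) * p j) + B i j * (conj (q i) * q j)) * w j
        = conj (p i) * (A i j * (p j * w j)) := fun j hj => by rw [hqP j hj]; ring
    rw [Finset.sum_congr rfl h1, Finset.sum_congr rfl h2]
    ring
  have h1 : ∀ j ∈ S₀, q j * w j = -(f j * (q k * w k)) := by
    intro j hj
    refine eq_neg_of_add_eq_zero_left
      (hB (fun j => q j * w j + f j * (q k * w k)) (fun i hi => ?_) j hj)
    have := hw' i
    rw [hp₀ i hi, map_zero, zero_mul, mul_zero, add_zero] at this
    have h0 := (mul_eq_zero.1 this).resolve_left ((map_ne_zero _).2 (hq i hi))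
    rw [← h0, ← hf i hi, Finset.sum_mul, ← Finset.sum_add_distrib]
    exact Finset.sum_congr rfl fun j _ => by ring
  have h2 : ∀ j ∈ P, p j * w j = η * g j - e j * (p k * w k) := by
    intro j hj
    refine sub_eq_zero.1
      (hA (fun j => p j * w j - (η * g j - e j * (p k * w k))) (fun i hi => ?_) j hj)
    have := hw' i
    rw [hqP i hi, map_zero, zero_mul, zero_add, mul_comm η] at this
    have h0 := mul_left_cancel₀ ((map_ne_zero _).2 (hp i hi)) this
    rw [← he i hi] at h0
    have hη : ∑ j ∈ P, A i j * (η * g j) = η := by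
      simp_rw [mul_left_comm _ η, ← Finset.mul_sum, hg i hi, mul_one]
    rw [← sub_eq_zero.2 (h0.trans hη.symm), Finset.sum_mul,
      ← Finset.sum_add_distrib, ← Finset.sum_sub_distrib]
    exact Finset.sum_congr rfl fun j _ => by ring
  refine ⟨h1, h2, ?_⟩
  have h3 := hw' k
  have e1 : ∑ j ∈ S₀, B k j * (q j * w j) = -((∑ j ∈ S₀, B k j * f j) * (q k * w k)) := by
    rw [Finset.sum_mul, ← Finset.sum_neg_distrib]
    exact Finset.sum_congr rfl fun j hj => by rw [h1 j hj]; ring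
  have e2 : ∑ j ∈ P, A k j * (p j * w j)
      = η * (∑ j ∈ P, A k j * g j) - (∑ j ∈ P, A k j * e j) * (p k * w k) := by
    rw [Finset.sum_mul, Finset.mul_sum, ← Finset.sum_sub_distrib]
    exact Finset.sum_congr rfl fun j hj => by rw [h2 j hj]; ring
  rw [e1, e2] at h3
  linear_combination h3

/-! ### The soliton matrix in amplitude variables -/

noncomputable section

variable {N : ℕ}

/-- The coefficient of `e^{θ_i^* + θ_j}` in `m_{i,j}`. -/
def alphaEntry (lam : Fin N → ℂ) (i j : Fin N) : ℂ :=
  2 * conj (zpar lam i) * zpar lam j / (zpar lam j - conj (zpar lam i)) * lam j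

/-- The matrix `M` as a function of independent amplitudes `p_i`, `q_i` in place of `e^{θ_i}`,
`e^{-θ_i}`. -/
def ampMat (σ : ℝ) (lam : Fin N → ℂ) (c : Fin N → Fin 2 → ℂ) (p q : Fin N → ℂ) :
    Matrix (Fin N) (Fin N) ℂ :=
  Matrix.of fun i j => alphaEntry lam i j * (conj (p i) * p j)
    + 2 * conj (lam i) * cauchyEntry σ lam c i j * (conj (q i) * q j)

/-- The bordered matrix of the `N`-soliton as a function of independent amplitudes. -/
def ampBorder (σ : ℝ) (lam : Fin N → ℂ) (c : Fin N → Fin 2 → ℂ) (s : Fin 2) (p q : Fin N → ℂ) :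
    Matrix (Fin N ⊕ Unit) (Fin N ⊕ Unit) ℂ :=
  Matrix.fromBlocks (ampMat σ lam c p q) (Matrix.of fun i _ => conj (p i))
    (Matrix.of fun _ j => c j s * q j) 0

/-- The single soliton attached to a partition `S₀ ∪ {k} ∪ P` of the indices, `S = S₀ ∪ {k}`. -/
def partSoliton (σ : ℝ) (lam : Fin N → ℂ) (c : Fin N → Fin 2 → ℂ) (s : Fin 2)
    (S S₀ P : Finset (Fin N)) (k : Fin N) (x t : ℝ) : ℂ :=
  cHat σ lam c s S S₀ P k * zfac lam k * (Complex.exp (2 * conj (thetaHat lam P k x t)) /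
    solDenom (lam k) (deltaC σ lam c S S₀ k) (thetaHat lam P k x t))

theorem zpar_ne_zero {lam : Fin N → ℂ} (hz : ∀ i, (zpar lam i).im < 0) (i : Fin N) :
    zpar lam i ≠ 0 := by
  intro h
  have := hz i
  simp [h] at this

theorem lam_ne_zero {lam : Fin N → ℂ} (hz : ∀ i, (zpar lam i).im < 0) (i : Fin N) :
    lam i ≠ 0 := by
  intro h
  have := hz i
  simp [zpar, h] at this

theorem zpar_sub_conj_ne_zero {lam : Fin N → ℂ} (hz : ∀ i, (zpar lam i).im < 0) (i j : Fin N) :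
    zpar lam j - conj (zpar lam i) ≠ 0 := by
  intro h
  have := congrArg Complex.im h
  simp at this
  linarith [hz i, hz j]

theorem zpar_injective {lam : Fin N → ℂ} (hv : Function.Injective (vel lam)) :
    Function.Injective (zpar lam) := fun i j h => hv (by simp only [vel, h])

theorem cauchyEntry_eq (σ : ℝ) (lam : Fin N → ℂ) (c : Fin N → Fin 2 → ℂ) (i j : Fin N) :
    cauchyEntry σ lam c i j
      = conj (zpar lam i) * zpar lam j * gam σ c i j / (zpar lam j - conj (zpar lam i)) := by
  simp only [cauchyEntry, gam, dotProduct, Matrix.mulVec_diagonal, Fin.sum_univ_two,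
    Pi.star_apply, Pi.smul_apply, smul_eq_mul, star_mul', RCLike.star_def, Matrix.cons_val_zero,
    Matrix.cons_val_one]
  ring

theorem conj_cauchyEntry (σ : ℝ) (lam : Fin N → ℂ) (c : Fin N → Fin 2 → ℂ) (i j : Fin N) :
    conj (cauchyEntry σ lam c j i) = -cauchyEntry σ lam c i j := by
  simp only [cauchyEntry_eq, gam, map_div₀, map_mul, map_sub, map_add, map_neg, Complex.conj_conj,
    Complex.conj_ofReal]
  rw [← neg_sub (zpar lam j), div_neg]
  ring

theorem conj_det_cauchyMat (σ : ℝ) (lam : Fin N → ℂ) (c : Fin N → Fin 2 → ℂ)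
    (S : Finset (Fin N)) :
    conj (cauchyMat σ lam c S).det = (-1) ^ S.card * (cauchyMat σ lam c S).det := by
  have h : (cauchyMat σ lam c S).conjTranspose = -cauchyMat σ lam c S := by
    ext i j
    simp [cauchyMat, Matrix.conjTranspose_apply, conj_cauchyEntry]
  have := Matrix.det_conjTranspose (cauchyMat σ lam c S)
  rw [h, Matrix.det_neg, Fintype.card_coe] at this
  exact this.symm

/-- For `σ = 1` one has `Λ = -I`, so `-C` is a Gram–Cauchy matrix. For `σ = -1` the form is
indefinite and this argument breaks down. -/
theorem det_cauchyMat_ne_zero_of_one {lam : Fin N → ℂ} {c : Fin N → Fin 2 → ℂ}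
    (hz : ∀ i, (zpar lam i).im < 0) (hv : Function.Injective (vel lam)) (hc : ∀ i, c i ≠ 0)
    (S : Finset (Fin N)) : (cauchyMat 1 lam c S).det ≠ 0 := by
  refine det_ne_zero_of_sum_eq_zero_imp (fun i j => cauchyEntry 1 lam c i j) S fun v hv' => ?_
  refine gramCauchy_injective S (zpar lam) (fun i => zpar lam i • c i) hz (zpar_injective hv)
    (fun i _ => smul_ne_zero (zpar_ne_zero hz i) (hc i)) v fun i hi => ?_
  rw [← neg_eq_zero, ← hv' i hi, ← Finset.sum_neg_distrib]
  refine Finset.sum_congr rfl fun j _ => ?_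
  simp only [cauchyEntry_eq, gam, Fin.sum_univ_two, Pi.smul_apply, smul_eq_mul, map_mul]
  push_cast
  ring

/-- Up to nonzero row and column factors this is the plain Cauchy matrix `1 / (z_j - z_i^*)`, the
Gram case with all vectors equal to the scalar `1`. -/
theorem alphaEntry_injective {lam : Fin N → ℂ} (hz : ∀ i, (zpar lam i).im < 0)
    (hv : Function.Injective (vel lam)) (P : Finset (Fin N)) (v : Fin N → ℂ)
    (hv' : ∀ i ∈ P, ∑ j ∈ P, alphaEntry lam i j * v j = 0) : ∀ j ∈ P, v j = 0 := by
  have h := gramCauchy_injective (κ := Unit) P (zpar lam) (fun _ _ => 1) hz (zpar_injective hv)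
    (fun i _ => one_ne_zero) (fun j => zpar lam j * lam j * v j) fun i hi => by
      have h0 : (2 * conj (zpar lam i)) ≠ 0 :=
        mul_ne_zero two_ne_zero ((map_ne_zero _).2 (zpar_ne_zero hz i))
      refine (mul_eq_zero.1 (Eq.trans ?_ (hv' i hi))).resolve_left h0
      rw [Finset.mul_sum]
      refine Finset.sum_congr rfl fun j _ => ?_
      simp only [alphaEntry, Finset.univ_unique, Finset.sum_singleton, map_one]
      ring
  intro j hj
  simpa [zpar_ne_zero hz j, lam_ne_zero hz j] using h j hj

/-- Interpolation with `y_i = z_i^*`, `a = z_k`, `w = z_k^*`. The product is the squared modulus of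
the shift that `P` imposes on `e^{2θ_k}`. -/
theorem alpha_schur {lam : Fin N → ℂ} (hz : ∀ i, (zpar lam i).im < 0)
    (hv : Function.Injective (vel lam)) {P : Finset (Fin N)} (k : Fin N) (e : Fin N → ℂ)
    (he : ∀ i ∈ P, ∑ j ∈ P, alphaEntry lam i j * e j = alphaEntry lam i k) :
    alphaEntry lam k k - ∑ j ∈ P, alphaEntry lam k j * e j
      = alphaEntry lam k k * ∏ j ∈ P,
          ((zpar lam j - zpar lam k) * (conj (zpar lam j) - conj (zpar lam k))
            / ((conj (zpar lam j) - zpar lam k) * (zpar lam j - conj (zpar lam k)))) := by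
  have hz0 := zpar_ne_zero hz
  have hl0 := lam_ne_zero hz
  have hzc := zpar_sub_conj_ne_zero hz
  have hc0 : ∀ i, conj (zpar lam i) ≠ 0 := fun i => (map_ne_zero _).2 (hz0 i)
  have h := cauchy_interpolation P (zpar lam) (fun i => conj (zpar lam i)) (zpar lam k)
    (conj (zpar lam k)) (fun j => zpar lam j * lam j * e j / (zpar lam k * lam k))
    (fun i _ j _ hij => zpar_injective hv (star_injective hij)) (fun i _ j _ => hzc i j)
    (fun i _ => by rw [← neg_sub]; exact neg_ne_zero.2 (hzc i k)) (fun j _ => hzc k j)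
    (fun i hi => by
      have h1 := he i hi
      have h2 : alphaEntry lam i k ≠ 0 := by
        simp [alphaEntry, hz0, hl0, hzc]
      rw [← div_self h2]
      nth_rewrite 1 [← h1]
      rw [Finset.sum_div]
      refine Finset.sum_congr rfl fun j _ => ?_
      simp only [alphaEntry]
      field_simp [hz0 k, hl0 k, hzc i k, hzc i j, hc0 i])
  rw [← h, mul_sub, mul_one, Finset.mul_sum]
  congr 1
  refine Finset.sum_congr rfl fun j _ => ?_
  simp only [alphaEntry]
  field_simp [hz0 k, hl0 k, hzc k k, hzc k j, hc0 k]

/-- The same interpolation with `a = 0`. It produces the factors `z_j² / |z_j|²` of the amplitude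
and the conjugate of the shift. -/
theorem alpha_residual {lam : Fin N → ℂ} (hz : ∀ i, (zpar lam i).im < 0)
    (hv : Function.Injective (vel lam)) {P : Finset (Fin N)} (k : Fin N) (g : Fin N → ℂ)
    (hg : ∀ i ∈ P, ∑ j ∈ P, alphaEntry lam i j * g j = 1) :
    1 - ∑ j ∈ P, alphaEntry lam k j * g j
      = ∏ j ∈ P, ((zpar lam j) ^ 2 / ((‖zpar lam j‖ ^ 2 : ℝ) : ℂ) *
          ((conj (zpar lam j) - conj (zpar lam k)) / (zpar lam j - conj (zpar lam k)))) := by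
  have hz0 := zpar_ne_zero hz
  have hzc := zpar_sub_conj_ne_zero hz
  have hc0 : ∀ i, conj (zpar lam i) ≠ 0 := fun i => (map_ne_zero _).2 (hz0 i)
  have key : ∀ i j, (0 - conj (zpar lam i)) / (zpar lam j - conj (zpar lam i)) *
      (-(2 * zpar lam j * lam j * g j)) = alphaEntry lam i j * g j := by
    intro i j
    simp only [alphaEntry]
    ring
  have h := cauchy_interpolation P (zpar lam) (fun i => conj (zpar lam i)) 0
    (conj (zpar lam k)) (fun j => -(2 * zpar lam j * lam j * g j))
    (fun i _ j _ hij => zpar_injective hv (star_injective hij)) (fun i _ j _ => hzc i j)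
    (fun i _ => by rw [sub_zero]; exact hc0 i) (fun j _ => hzc k j)
    (fun i hi => by rw [← hg i hi]; exact Finset.sum_congr rfl fun j _ => key i j)
  simp_rw [key] at h
  rw [h]
  refine Finset.prod_congr rfl fun j _ => ?_
  rw [← Complex.normSq_eq_norm_sq, Complex.normSq_eq_conj_mul_self]
  field_simp [hz0 j, hc0 j, hzc k j]
  ring

theorem alpha_exists {lam : Fin N → ℂ} (hz : ∀ i, (zpar lam i).im < 0)
    (hv : Function.Injective (vel lam)) (P : Finset (Fin N)) (b : Fin N → ℂ) :
    ∃ v : Fin N → ℂ, ∀ i ∈ P, ∑ j ∈ P, alphaEntry lam i j * v j = b i :=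
  exists_sum_eq_of_det_ne_zero _ P
    (det_ne_zero_of_sum_eq_zero_imp _ P (alphaEntry_injective hz hv P)) b

end

/-! ### Reality of the constants and size of a single soliton -/

/-- Multiplying by `l`, respectively by its conjugate, makes one of the two terms real, so the
imaginary part is `Im(l²) A`, respectively `-Im(l²) B`. Two real terms thus cannot cancel each
other. -/
theorem abs_im_sq_mul_le (l : ℂ) (A B : ℝ) :
    |(l ^ 2).im| * |A| ≤ ‖l‖ * ‖l * A + conj l * B‖ ∧
      |(l ^ 2).im| * |B| ≤ ‖l‖ * ‖l * A + conj l * B‖ := by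
  constructor
  · rw [← norm_mul, ← abs_mul]
    refine le_trans (le_of_eq ?_) (Complex.abs_im_le_norm _)
    congr 1
    simp [pow_two]
    ring
  · rw [← Complex.norm_conj l, ← norm_mul, ← abs_mul, ← abs_neg]
    refine le_trans (le_of_eq ?_) (Complex.abs_im_le_norm _)
    congr 1
    simp [pow_two]
    ring

noncomputable section

variable {N : ℕ}

theorem im_lam_sq_ne_zero {lam : Fin N → ℂ} (hz : ∀ i, (zpar lam i).im < 0) (i : Fin N) :
    (lam i ^ 2).im ≠ 0 := by
  intro h
  have := hz i
  simp [zpar, Complex.inv_im, h] at this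

theorem zfac_ne_zero {lam : Fin N → ℂ} (hz : ∀ i, (zpar lam i).im < 0) (k : Fin N) :
    zfac lam k ≠ 0 := by
  have h := zpar_ne_zero hz k
  refine div_ne_zero (zpar_sub_conj_ne_zero hz k k) ?_
  exact_mod_cast pow_ne_zero 2 (norm_ne_zero_iff.2 h)

theorem conj_zfac (lam : Fin N → ℂ) (k : Fin N) : conj (zfac lam k) = -zfac lam k := by
  simp only [zfac, map_div₀, map_sub, Complex.conj_conj, Complex.conj_ofReal]
  rw [← neg_sub, neg_div]

/-- Conjugation multiplies an anti-Hermitian determinant of size `n` by `(-1)^n`. The ratio for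
consecutive sizes is therefore purely imaginary, and so is `zfac`. -/
theorem deltaC_eq_ofReal (σ : ℝ) (lam : Fin N → ℂ) (c : Fin N → Fin 2 → ℂ)
    {S₀ : Finset (Fin N)} {k : Fin N} (hk : k ∉ S₀) :
    ((deltaC σ lam c (insert k S₀) S₀ k).re : ℂ) = deltaC σ lam c (insert k S₀) S₀ k := by
  rw [← Complex.conj_eq_iff_re]
  simp only [deltaC, map_mul, map_div₀, conj_zfac, conj_det_cauchyMat, Finset.card_insert_of_notMem hk]
  have h : ((-1 : ℂ) ^ S₀.card) ≠ 0 := pow_ne_zero _ (by norm_num)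
  rw [pow_succ, mul_assoc, mul_div_mul_left _ _ h]
  ring

theorem deltaC_ne_zero {σ : ℝ} {lam : Fin N → ℂ} {c : Fin N → Fin 2 → ℂ}
    (hz : ∀ i, (zpar lam i).im < 0) {S S₀ : Finset (Fin N)} {k : Fin N}
    (hS₀ : (cauchyMat σ lam c S₀).det ≠ 0) (hS : (cauchyMat σ lam c S).det ≠ 0) :
    deltaC σ lam c S S₀ k ≠ 0 :=
  mul_ne_zero (zfac_ne_zero hz k) (div_ne_zero hS hS₀)

/-- The factor by which the particles in `P` shift `e^{2θ_k}`. -/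
def shiftFactor (lam : Fin N → ℂ) (P : Finset (Fin N)) (k : Fin N) : ℂ :=
  ∏ j ∈ P, (zpar lam j - zpar lam k) / (conj (zpar lam j) - zpar lam k)

theorem shiftFactor_ne_zero {lam : Fin N → ℂ} (hz : ∀ i, (zpar lam i).im < 0)
    (hv : Function.Injective (vel lam)) {P : Finset (Fin N)} {k : Fin N} (hk : k ∉ P) :
    shiftFactor lam P k ≠ 0 := by
  refine Finset.prod_ne_zero_iff.2 fun j hj => div_ne_zero (sub_ne_zero.2 fun h => hk ?_) ?_
  · rwa [← zpar_injective hv h]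
  · rw [← neg_sub]
    exact neg_ne_zero.2 (zpar_sub_conj_ne_zero hz j k)

/-- Doubling removes the factor `1/2` before exponentiation, so the branch of the logarithm plays no
role. -/
theorem exp_two_thetaHat {lam : Fin N → ℂ} (hz : ∀ i, (zpar lam i).im < 0)
    (hv : Function.Injective (vel lam)) {P : Finset (Fin N)} {k : Fin N} (hk : k ∉ P) (x t : ℝ) :
    Complex.exp (2 * thetaHat lam P k x t)
      = Complex.exp (theta lam k x t) ^ 2 * shiftFactor lam P k := by
  have h0 := Finset.prod_ne_zero_iff.1 (shiftFactor_ne_zero hz hv hk)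
  rw [thetaHat, mul_add, ← mul_assoc, show (2 : ℂ) * (1 / 2) = 1 by norm_num, one_mul,
    Complex.exp_add, Complex.exp_sum, pow_two, ← Complex.exp_add, two_mul, shiftFactor]
  congr 1
  exact Finset.prod_congr rfl fun j hj => Complex.exp_log (h0 j hj)

theorem exp_two_conj_thetaHat {lam : Fin N → ℂ} (hz : ∀ i, (zpar lam i).im < 0)
    (hv : Function.Injective (vel lam)) {P : Finset (Fin N)} {k : Fin N} (hk : k ∉ P) (x t : ℝ) :
    Complex.exp (2 * conj (thetaHat lam P k x t))
      = conj (Complex.exp (theta lam k x t)) ^ 2 * conj (shiftFactor lam P k) := by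
  rw [← map_pow, ← map_mul, ← exp_two_thetaHat hz hv hk x t, ← Complex.exp_conj, map_mul,
    Complex.conj_ofNat]

theorem solDenom_thetaHat {lam : Fin N → ℂ} (hz : ∀ i, (zpar lam i).im < 0)
    (hv : Function.Injective (vel lam)) {P : Finset (Fin N)} {k : Fin N} (hk : k ∉ P) (x t : ℝ)
    (l δ : ℂ) :
    solDenom l δ (thetaHat lam P k x t)
      = l * ((‖Complex.exp (theta lam k x t)‖ ^ 4 * ‖shiftFactor lam P k‖ ^ 2 : ℝ) : ℂ)
        + conj l * δ := by
  rw [solDenom, mul_add, Complex.exp_add, exp_two_thetaHat hz hv hk, exp_two_conj_thetaHat hz hv hk]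
  push_cast
  rw [show (4 : ℕ) = 2 * 2 from rfl, pow_mul]
  simp only [← Complex.conj_mul']
  ring

/-- The exponential term is strictly positive and `δ` is real, so the first term alone bounds the
modulus from below. The value `δ = 0` is harmless here. -/
theorem solDenom_ne_zero {σ : ℝ} {lam : Fin N → ℂ} {c : Fin N → Fin 2 → ℂ}
    (hz : ∀ i, (zpar lam i).im < 0) (hv : Function.Injective (vel lam))
    {S₀ P : Finset (Fin N)} {k : Fin N} (hk₀ : k ∉ S₀) (hkP : k ∉ P) (x t : ℝ) :
    solDenom (lam k) (deltaC σ lam c (insert k S₀) S₀ k) (thetaHat lam P k x t) ≠ 0 := by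
  intro h
  rw [solDenom_thetaHat hz hv hkP, ← deltaC_eq_ofReal σ lam c hk₀] at h
  have h1 := (abs_im_sq_mul_le (lam k) (‖Complex.exp (theta lam k x t)‖ ^ 4 *
    ‖shiftFactor lam P k‖ ^ 2) (deltaC σ lam c (insert k S₀) S₀ k).re).1
  rw [h, norm_zero, mul_zero] at h1
  have h2 : 0 < |(lam k ^ 2).im| := abs_pos.2 (im_lam_sq_ne_zero hz k)
  have h3 : 0 < |‖Complex.exp (theta lam k x t)‖ ^ 4 * ‖shiftFactor lam P k‖ ^ 2| := by
    have := shiftFactor_ne_zero hz hv hkP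
    have := Complex.exp_ne_zero (theta lam k x t)
    exact abs_pos.2 (by positivity)
  exact absurd h1 (not_le.2 (mul_pos h2 h3))

/-- Away from its centre a single soliton is exponentially small. -/
theorem exists_norm_partSoliton_le {σ : ℝ} {lam : Fin N → ℂ} {c : Fin N → Fin 2 → ℂ}
    (hz : ∀ i, (zpar lam i).im < 0) (hv : Function.Injective (vel lam)) (s : Fin 2)
    {S₀ P : Finset (Fin N)} {k : Fin N} (hk₀ : k ∉ S₀) (hkP : k ∉ P)
    (hS₀ : (cauchyMat σ lam c S₀).det ≠ 0) (hS : (cauchyMat σ lam c (insert k S₀)).det ≠ 0) :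
    ∃ K : ℝ, 0 ≤ K ∧ ∀ x t : ℝ, ‖partSoliton σ lam c s (insert k S₀) S₀ P k x t‖
      ≤ K * Real.exp (-2 * |(theta lam k x t).re|) := by
  set δ := deltaC σ lam c (insert k S₀) S₀ k with hδ
  have hδ0 : δ ≠ 0 := deltaC_ne_zero hz hS₀ hS
  have hδr : ((δ.re : ℝ) : ℂ) = δ := deltaC_eq_ofReal σ lam c hk₀
  have hδr0 : δ.re ≠ 0 := fun h => hδ0 (by rw [← hδr, h, Complex.ofReal_zero])
  set X := shiftFactor lam P k with hX
  have hX0 : 0 < ‖X‖ := norm_pos_iff.2 (shiftFactor_ne_zero hz hv hkP)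
  have hI : 0 < |(lam k ^ 2).im| := abs_pos.2 (im_lam_sq_ne_zero hz k)
  have hl : 0 < ‖lam k‖ := norm_pos_iff.2 (lam_ne_zero hz k)
  set a := cHat σ lam c s (insert k S₀) S₀ P k * zfac lam k with ha
  set K₁ := ‖lam k‖ / |(lam k ^ 2).im| * (1 / ‖X‖) with hK₁
  set K₂ := ‖lam k‖ / |(lam k ^ 2).im| * (‖X‖ / |δ.re|) with hK₂
  have hK₁' : 0 ≤ K₁ := by positivity
  have hK₂' : 0 ≤ K₂ := by positivity
  refine ⟨‖a‖ * (K₁ + K₂), by positivity, fun x t => ?_⟩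
  rw [partSoliton, ← ha, norm_mul, mul_assoc]
  refine mul_le_mul_of_nonneg_left ?_ (norm_nonneg _)
  rw [norm_div, exp_two_conj_thetaHat hz hv hkP, solDenom_thetaHat hz hv hkP, norm_mul, norm_pow,
    Complex.norm_conj, Complex.norm_conj, ← hδ, ← hX]
  obtain ⟨b1, b2⟩ := abs_im_sq_mul_le (lam k) (‖Complex.exp (theta lam k x t)‖ ^ 4 * ‖X‖ ^ 2) δ.re
  rw [hδr] at b1 b2
  set D := ‖lam k * ((‖Complex.exp (theta lam k x t)‖ ^ 4 * ‖X‖ ^ 2 : ℝ) : ℂ) + conj (lam k) * δ‖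
    with hD
  rw [abs_of_nonneg (a := ‖Complex.exp (theta lam k x t)‖ ^ 4 * ‖X‖ ^ 2) (by positivity)] at b1
  rw [Complex.norm_exp] at b1 ⊢
  set y := (theta lam k x t).re with hy
  have hD0 : 0 < D := by
    have : 0 < ‖lam k‖ * D := lt_of_lt_of_le (mul_pos hI (abs_pos.2 hδr0)) b2
    exact pos_of_mul_pos_right this hl.le
  have he : 0 < Real.exp y := Real.exp_pos y
  rw [div_le_iff₀ hD0]
  have hδp : 0 < |δ.re| := abs_pos.2 hδr0
  -- Ahead of the centre the exponential term of the denominator dominates; behind it, the constant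
  -- term does, which is where `δ ≠ 0` is needed.
  rcases le_total 0 y with h | h
  · have h1 : Real.exp y ^ 2 * ‖X‖ ≤ K₁ * Real.exp (-2 * |y|) * D := by
      rw [abs_of_nonneg h, hK₁]
      have e : Real.exp (-2 * y) = 1 / Real.exp y ^ 2 := by
        rw [← Real.exp_nat_mul, one_div, ← Real.exp_neg]
        push_cast
        ring_nf
      rw [e]
      have : ‖lam k‖ / |(lam k ^ 2).im| * (1 / ‖X‖) * (1 / Real.exp y ^ 2) * D
          = (‖lam k‖ * D) / (|(lam k ^ 2).im| * ‖X‖ * Real.exp y ^ 2) := by field_simp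
      rw [this, le_div_iff₀ (by positivity)]
      refine le_trans (le_of_eq ?_) b1
      ring
    refine h1.trans ?_
    gcongr
    linarith
  · have h1 : Real.exp y ^ 2 * ‖X‖ ≤ K₂ * Real.exp (-2 * |y|) * D := by
      rw [abs_of_nonpos h, hK₂]
      have e : Real.exp (-2 * -y) = Real.exp y ^ 2 := by
        rw [← Real.exp_nat_mul]
        push_cast
        ring_nf
      rw [e]
      have : ‖lam k‖ / |(lam k ^ 2).im| * (‖X‖ / |δ.re|) * Real.exp y ^ 2 * D
          = (Real.exp y ^ 2 * ‖X‖) * ((‖lam k‖ * D) / (|(lam k ^ 2).im| * |δ.re|)) := by field_simp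
      rw [this]
      refine le_mul_of_one_le_right (by positivity) ?_
      rw [one_le_div (by positivity)]
      exact b2
    refine h1.trans ?_
    gcongr
    linarith

/-! ### Exact reduction at truncated amplitudes -/

/-- Evaluation of the bordered determinant from a solution of the linear system. -/
theorem ampBorder_det_div {σ : ℝ} {lam : Fin N → ℂ} {c : Fin N → Fin 2 → ℂ} (s : Fin 2)
    {p q w : Fin N → ℂ} (hdet : (ampMat σ lam c p q).det ≠ 0)
    (hw : (ampMat σ lam c p q).mulVec w = fun i => conj (p i)) :
    -2 * ((ampBorder σ lam c s p q).det / (ampMat σ lam c p q).det)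
      = 2 * ∑ j, c j s * (q j * w j) := by
  let _ : Invertible (ampMat σ lam c p q) :=
    Matrix.invertibleOfIsUnitDet _ (isUnit_iff_ne_zero.2 hdet)
  have hB : (Matrix.of fun (i : Fin N) (_ : Unit) => conj (p i))
      = ampMat σ lam c p q * Matrix.of fun (j : Fin N) (_ : Unit) => w j := by
    ext i u
    exact (congrFun hw i).symm
  rw [ampBorder, Matrix.det_fromBlocks₁₁, mul_div_cancel_left₀ _ hdet, hB, Matrix.mul_assoc,
    Matrix.invOf_mul_cancel_left, Matrix.det_unique]
  simp only [Matrix.sub_apply, Matrix.zero_apply, Matrix.mul_apply, Matrix.of_apply]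
  simp_rw [mul_assoc]
  ring

/-- The common denominator of the soliton quotient at truncated amplitudes. -/
def ampDenom (σ : ℝ) (lam : Fin N → ℂ) (c : Fin N → Fin 2 → ℂ) (S S₀ P : Finset (Fin N))
    (k : Fin N) (a b : ℂ) : ℂ :=
  lam k * ((‖a‖ ^ 2 * ‖shiftFactor lam P k‖ ^ 2 : ℝ) : ℂ)
    + conj (lam k) * (deltaC σ lam c S S₀ k * ((‖b‖ ^ 2 : ℝ) : ℂ))

theorem ampDenom_ne_zero {σ : ℝ} {lam : Fin N → ℂ} {c : Fin N → Fin 2 → ℂ}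
    (hz : ∀ i, (zpar lam i).im < 0) (hv : Function.Injective (vel lam))
    {S₀ P : Finset (Fin N)} {k : Fin N} (hk₀ : k ∉ S₀) (hkP : k ∉ P)
    (hS₀ : (cauchyMat σ lam c S₀).det ≠ 0) (hS : (cauchyMat σ lam c (insert k S₀)).det ≠ 0)
    {a b : ℂ} (hab : a ≠ 0 ∨ b ≠ 0) : ampDenom σ lam c (insert k S₀) S₀ P k a b ≠ 0 := by
  have hδ0 : deltaC σ lam c (insert k S₀) S₀ k ≠ 0 := deltaC_ne_zero hz hS₀ hS
  have hδr := deltaC_eq_ofReal σ lam c hk₀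
  have hX := shiftFactor_ne_zero hz hv hkP
  have hI : (lam k ^ 2).im ≠ 0 := im_lam_sq_ne_zero hz k
  intro h
  rw [ampDenom, ← hδr, ← Complex.ofReal_mul] at h
  obtain ⟨b1, b2⟩ := abs_im_sq_mul_le (lam k) (‖a‖ ^ 2 * ‖shiftFactor lam P k‖ ^ 2)
    ((deltaC σ lam c (insert k S₀) S₀ k).re * ‖b‖ ^ 2)
  rw [h, norm_zero, mul_zero, ← abs_mul] at b1 b2
  have c1 := abs_nonpos_iff.1 b1
  have c2 := abs_nonpos_iff.1 b2
  have hδr0 : (deltaC σ lam c (insert k S₀) S₀ k).re ≠ 0 :=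
    fun h => hδ0 (by rw [← hδr, h, Complex.ofReal_zero])
  simp [hI, hX, hδr0] at c1 c2
  rcases hab with h | h
  · exact h c1
  · exact h c2

/-- After elimination of `S₀` and `P`, the coefficient of `w k` is a nonzero multiple of `ampDenom`.
This gives both invertibility and the value of the quotient. -/
theorem ampMat_truncated {σ : ℝ} {lam : Fin N → ℂ} {c : Fin N → Fin 2 → ℂ}
    (hz : ∀ i, (zpar lam i).im < 0) (hv : Function.Injective (vel lam))
    {S₀ P : Finset (Fin N)} {k : Fin N} (hk₀ : k ∉ S₀) (hkP : k ∉ P) (hd : Disjoint S₀ P)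
    (hu : ∀ i, i ∈ S₀ ∨ i = k ∨ i ∈ P)
    (hS₀ : (cauchyMat σ lam c S₀).det ≠ 0) (hS : (cauchyMat σ lam c (insert k S₀)).det ≠ 0)
    {p q : Fin N → ℂ} (hp₀ : ∀ i ∈ S₀, p i = 0) (hqP : ∀ i ∈ P, q i = 0)
    (hp : ∀ i ∈ P, p i ≠ 0) (hq : ∀ i ∈ S₀, q i ≠ 0) (hpq : p k ≠ 0 ∨ q k ≠ 0) :
    (ampMat σ lam c p q).det ≠ 0 ∧
    ∀ s, -2 * ((ampBorder σ lam c s p q).det / (ampMat σ lam c p q).det)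
      = cHat σ lam c s (insert k S₀) S₀ P k * zfac lam k *
        (q k * conj (p k) * conj (shiftFactor lam P k)
          / ampDenom σ lam c (insert k S₀) S₀ P k (p k) (q k)) := by
  have hl0 := lam_ne_zero hz
  have hz0 := zpar_ne_zero hz
  obtain ⟨f, hf⟩ := exists_sum_eq_of_det_ne_zero (fun i j => cauchyEntry σ lam c i j) S₀ hS₀
    (fun i => cauchyEntry σ lam c i k)
  obtain ⟨g, hg⟩ := alpha_exists hz hv P fun _ => 1
  obtain ⟨e, he⟩ := alpha_exists hz hv P fun i => alphaEntry lam i k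
  have hscale : ∀ (v : Fin N → ℂ) (i : Fin N) (T : Finset (Fin N)),
      ∑ j ∈ T, 2 * conj (lam i) * cauchyEntry σ lam c i j * v j
        = 2 * conj (lam i) * ∑ j ∈ T, cauchyEntry σ lam c i j * v j := by
    intro v i T
    rw [Finset.mul_sum]
    exact Finset.sum_congr rfl fun j _ => by ring
  have hl2 : ∀ i, 2 * conj (lam i) ≠ 0 := fun i =>
    mul_ne_zero two_ne_zero ((map_ne_zero _).2 (hl0 i))
  have hdS := det_insert_eq (fun i j => cauchyEntry σ lam c i j) S₀ k hk₀ hS₀ f hf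
  change (cauchyMat σ lam c (insert k S₀)).det = (cauchyMat σ lam c S₀).det * _ at hdS
  have hpi : ∏ j ∈ P, ((zpar lam j - zpar lam k) * (conj (zpar lam j) - conj (zpar lam k))
      / ((conj (zpar lam j) - zpar lam k) * (zpar lam j - conj (zpar lam k))))
      = ((‖shiftFactor lam P k‖ ^ 2 : ℝ) : ℂ) := by
    push_cast
    rw [← Complex.conj_mul', shiftFactor, map_prod, ← Finset.prod_mul_distrib]
    refine Finset.prod_congr rfl fun j _ => ?_
    simp only [map_div₀, map_sub, Complex.conj_conj]
    rw [div_mul_div_comm]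
    ring
  have hD0 := ampDenom_ne_zero hz hv hk₀ hkP hS₀ hS hpq
  set D := ampDenom σ lam c (insert k S₀) S₀ P k (p k) (q k) with hD
  have hf0 := zfac_ne_zero hz k
  have hDeq : conj (p k) * p k * (alphaEntry lam k k - ∑ j ∈ P, alphaEntry lam k j * e j)
        + conj (q k) * q k * (2 * conj (lam k) * cauchyEntry σ lam c k k
            - ∑ j ∈ S₀, 2 * conj (lam k) * cauchyEntry σ lam c k j * f j)
      = 2 / zfac lam k * D := by
    rw [alpha_schur hz hv k e he, hpi, hscale, hD, ampDenom, deltaC, hdS,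
      mul_div_cancel_left₀ _ hS₀, Complex.conj_mul', Complex.conj_mul']
    have ha : alphaEntry lam k k = 2 / zfac lam k * lam k := by
      rw [alphaEntry, zfac]
      push_cast
      rw [← Complex.conj_mul', div_div_eq_mul_div]
      ring
    rw [ha]
    push_cast
    field_simp
  -- The parameter `η` serves twice: `η = 0` shows that the kernel is trivial, `η = 1` computes the
  -- soliton.
  have solve := fun (w : Fin N → ℂ) (η : ℂ)
      (hw : ∀ i, ∑ j, ampMat σ lam c p q i j * w j = η * conj (p i)) =>
    block_solve hk₀ hkP hd hu (alphaEntry lam)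
      (fun i j => 2 * conj (lam i) * cauchyEntry σ lam c i j) f g e p q w η hp₀ hqP hp hq
      (fun v hv' => sum_eq_zero_imp_of_det_ne_zero (fun i j => cauchyEntry σ lam c i j) S₀ hS₀ v
        fun i hi => by
          have := hv' i hi
          rw [hscale] at this
          exact (mul_eq_zero.1 this).resolve_left (hl2 i))
      (alphaEntry_injective hz hv P)
      (fun i hi => by rw [hscale, hf i hi])
      hg he hw
  simp only [hDeq] at solve
  have hdet : (ampMat σ lam c p q).det ≠ 0 := by
    intro h0
    obtain ⟨w, hw0, hw⟩ := Matrix.exists_mulVec_eq_zero_iff.2 h0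
    obtain ⟨h1, h2, h3⟩ := solve w 0 fun i => by
      rw [zero_mul]
      exact congrFun hw i
    have hwk : w k = 0 := by
      rw [zero_mul, zero_mul] at h3
      exact (mul_eq_zero.1 h3).resolve_left (mul_ne_zero (div_ne_zero two_ne_zero hf0) hD0)
    refine hw0 (funext fun i => ?_)
    rcases hu i with hi | rfl | hi
    · simpa [hwk, hq i hi] using h1 i hi
    · exact hwk
    · simpa [hwk, hp i hi] using h2 i hi
  refine ⟨hdet, fun s => ?_⟩
  set w := (ampMat σ lam c p q)⁻¹.mulVec fun i => conj (p i) with hwdef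
  have hw : (ampMat σ lam c p q).mulVec w = fun i => conj (p i) := by
    rw [hwdef, Matrix.mulVec_mulVec, Matrix.mul_nonsing_inv _ (isUnit_iff_ne_zero.2 hdet),
      Matrix.one_mulVec]
  obtain ⟨h1, h2, h3⟩ := solve w 1 fun i => by
    rw [one_mul]
    exact congrFun hw i
  rw [ampBorder_det_div s hdet hw, sum_partition hk₀ hkP hd hu]
  have hP : ∑ j ∈ P, c j s * (q j * w j) = 0 :=
    Finset.sum_eq_zero fun j hj => by rw [hqP j hj, zero_mul, mul_zero]
  have hS₀' : ∑ j ∈ S₀, c j s * (q j * w j) = -((∑ j ∈ S₀, c j s * f j) * (q k * w k)) := by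
    rw [Finset.sum_mul, ← Finset.sum_neg_distrib]
    exact Finset.sum_congr rfl fun j hj => by rw [h1 j hj]; ring
  -- Only row `k` is replaced, so the same `f` solves the system over `S₀` and the Schur formula
  -- applies again.
  have hhat : (cauchyHat σ lam c s (insert k S₀) k).det
      = (cauchyMat σ lam c S₀).det * (c k s - ∑ j ∈ S₀, c j s * f j) := by
    have hrow : ∀ i ∈ S₀, i ≠ k := fun i hi h => hk₀ (h ▸ hi)
    have hsub : (Matrix.of fun i j : S₀ =>
        (fun i j => if i = k then c j s else cauchyEntry σ lam c i j) (i : Fin N) (j : Fin N))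
        = cauchyMat σ lam c S₀ := by
      ext i j
      simp [cauchyMat, hrow i i.2]
    have := det_insert_eq (fun i j => if i = k then c j s else cauchyEntry σ lam c i j) S₀ k hk₀
      (by rw [hsub]; exact hS₀) f (fun i hi => by simpa [hrow i hi] using hf i hi)
    rw [hsub] at this
    simpa [cauchyHat] using this
  rw [one_mul, alpha_residual hz hv k g hg, Finset.prod_mul_distrib] at h3
  have hX : ∏ j ∈ P, (conj (zpar lam j) - conj (zpar lam k)) / (zpar lam j - conj (zpar lam k))
      = conj (shiftFactor lam P k) := by
    simp [shiftFactor, map_prod]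
  rw [hX] at h3
  rw [hP, hS₀', cHat, hhat, mul_div_cancel_left₀ _ hS₀]
  have hwk : w k = zfac lam k / 2 * (conj (p k) * ((∏ j ∈ P, zpar lam j ^ 2 /
      ((‖zpar lam j‖ ^ 2 : ℝ) : ℂ)) * conj (shiftFactor lam P k))) / D := by
    rw [← h3]
    field_simp
  rw [hwk]
  ring

/-- The single soliton in terms of rescaled amplitudes. -/
theorem partSoliton_eq_amp {σ : ℝ} {lam : Fin N → ℂ} {c : Fin N → Fin 2 → ℂ}
    (hz : ∀ i, (zpar lam i).im < 0) (hv : Function.Injective (vel lam)) (s : Fin 2)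
    {S S₀ P : Finset (Fin N)} {k : Fin N} (hkP : k ∉ P) (x t r : ℝ) (hr : r ≠ 0) :
    partSoliton σ lam c s S S₀ P k x t
      = cHat σ lam c s S S₀ P k * zfac lam k *
        ((Complex.exp (-theta lam k x t) * r) * conj (Complex.exp (theta lam k x t) * r)
            * conj (shiftFactor lam P k)
          / ampDenom σ lam c S S₀ P k (Complex.exp (theta lam k x t) * r)
              (Complex.exp (-theta lam k x t) * r)) := by
  rw [partSoliton, exp_two_conj_thetaHat hz hv hkP, solDenom_thetaHat hz hv hkP, ampDenom]
  congr 1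
  set E := Complex.exp (theta lam k x t) with hE
  have hE0 : E ≠ 0 := Complex.exp_ne_zero _
  have hr' : (r : ℂ) ≠ 0 := Complex.ofReal_ne_zero.2 hr
  rw [Complex.exp_neg, ← hE]
  -- Numerator and denominator acquire the same factor `r² / |E|²`.
  have hm : E⁻¹ * (r : ℂ) * conj (E * (r : ℂ)) * conj (shiftFactor lam P k)
      = (conj E ^ 2 * conj (shiftFactor lam P k)) * ((r : ℂ) ^ 2 / (conj E * E)) := by
    rw [map_mul, Complex.conj_ofReal]
    field_simp [(map_ne_zero conj).2 hE0]
  have hm' : lam k * ((‖E * (r : ℂ)‖ ^ 2 * ‖shiftFactor lam P k‖ ^ 2 : ℝ) : ℂ)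
      + conj (lam k) * (deltaC σ lam c S S₀ k * ((‖E⁻¹ * (r : ℂ)‖ ^ 2 : ℝ) : ℂ))
      = (lam k * ((‖E‖ ^ 4 * ‖shiftFactor lam P k‖ ^ 2 : ℝ) : ℂ)
        + conj (lam k) * deltaC σ lam c S S₀ k) * ((r : ℂ) ^ 2 / (conj E * E)) := by
    rw [Complex.conj_mul', norm_mul, norm_mul, norm_inv, Complex.norm_real, mul_pow, mul_pow,
      Real.norm_eq_abs, sq_abs]
    push_cast
    have : (‖E‖ : ℂ) ≠ 0 := Complex.ofReal_ne_zero.2 (norm_ne_zero_iff.2 hE0)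
    field_simp
  rw [hm, hm', mul_div_mul_right]
  exact div_ne_zero (pow_ne_zero 2 hr') (mul_ne_zero ((map_ne_zero _).2 hE0) hE0)

end

/-! ### Lipschitz perturbation of the truncated amplitudes -/

theorem contDiff_det {E n : Type*} [NormedAddCommGroup E] [NormedSpace ℝ E] [Fintype n]
    [DecidableEq n] {A : E → Matrix n n ℂ} (h : ∀ i j, ContDiff ℝ 1 fun x => A x i j) :
    ContDiff ℝ 1 fun x => (A x).det := by
  simp only [Matrix.det_apply']
  exact ContDiff.sum fun τ _ => contDiff_const.mul (contDiff_prod fun i _ => h _ _)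

/-- A quotient of smooth functions is Lipschitz near a compact set without zeros of the
denominator. -/
theorem exists_norm_div_sub_div_le {E : Type*} [NormedAddCommGroup E] [NormedSpace ℝ E]
    [FiniteDimensional ℝ E] {n d : E → ℂ} (hn : ContDiff ℝ 1 n) (hd : ContDiff ℝ 1 d) {T : Set E}
    (hT : IsCompact T) (hT1 : T ⊆ Metric.closedBall 0 1) (hdT : ∀ u ∈ T, d u ≠ 0) :
    ∃ ε₀ > 0, ∃ K ≥ 0, ∀ u ∈ T, ∀ v, ‖v‖ ≤ 1 → ‖v - u‖ ≤ ε₀ →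
      d v ≠ 0 ∧ ‖n v / d v - n u / d u‖ ≤ K * ‖v - u‖ := by
  have : ProperSpace E := FiniteDimensional.proper_real E
  have hb : IsCompact (Metric.closedBall (0 : E) 1) := isCompact_closedBall 0 1
  obtain ⟨Ln, hLn⟩ := hn.contDiffOn.exists_lipschitzOnWith one_ne_zero (convex_closedBall 0 1) hb
  obtain ⟨Ld, hLd⟩ := hd.contDiffOn.exists_lipschitzOnWith one_ne_zero (convex_closedBall 0 1) hb
  obtain ⟨B, hB⟩ := hb.exists_bound_of_continuousOn hn.continuous.continuousOn
  obtain ⟨m, hm, hmT⟩ : ∃ m > 0, ∀ u ∈ T, m ≤ ‖d u‖ := by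
    rcases T.eq_empty_or_nonempty with rfl | hne
    · exact ⟨1, one_pos, by simp⟩
    · obtain ⟨u, hu, hmin⟩ := hT.exists_isMinOn hne hd.continuous.norm.continuousOn
      exact ⟨‖d u‖, norm_pos_iff.2 (hdT u hu), fun v hv => hmin hv⟩
  have hB0 : 0 ≤ B := (norm_nonneg _).trans (hB 0 (by simp))
  -- This radius keeps `‖d v‖ ≥ m / 2`; the `+ 1` covers `Ld = 0`.
  refine ⟨m / (2 * (Ld + 1)), by positivity, Ln * (2 / m) + B * Ld * (2 / m ^ 2), by positivity,
    fun u hu v hv huv => ?_⟩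
  have hv' : v ∈ Metric.closedBall (0 : E) 1 := by simpa using hv
  have hnv : ‖n v - n u‖ ≤ Ln * ‖v - u‖ := by
    simpa [dist_eq_norm] using hLn.dist_le_mul v hv' u (hT1 hu)
  have hdv : ‖d v - d u‖ ≤ Ld * ‖v - u‖ := by
    simpa [dist_eq_norm] using hLd.dist_le_mul v hv' u (hT1 hu)
  have hdv2 : ‖d v - d u‖ ≤ m / 2 := by
    refine hdv.trans ?_
    rw [le_div_iff₀ (by positivity)] at huv
    have := norm_nonneg (v - u)
    nlinarith
  have hdvm : m / 2 ≤ ‖d v‖ := by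
    have h1 := norm_sub_norm_le (d u) (d v)
    rw [norm_sub_rev] at h1
    linarith [hmT u hu]
  have hdv0 : d v ≠ 0 := norm_pos_iff.1 (lt_of_lt_of_le (half_pos hm) hdvm)
  refine ⟨hdv0, ?_⟩
  have hdu0 := hdT u hu
  have e : n v / d v - n u / d u
      = (n v - n u) * (d v)⁻¹ - n u * (d v - d u) * ((d v)⁻¹ * (d u)⁻¹) := by
    field_simp
    ring
  have i1 : ‖(d v)⁻¹‖ ≤ 2 / m := by
    rw [norm_inv, ← inv_div]
    exact inv_anti₀ (half_pos hm) hdvm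
  have i2 : ‖(d u)⁻¹‖ ≤ 1 / m := by
    rw [norm_inv, one_div]
    exact inv_anti₀ hm (hmT u hu)
  rw [e]
  refine (norm_sub_le _ _).trans ?_
  rw [norm_mul, norm_mul, norm_mul, norm_mul]
  calc ‖n v - n u‖ * ‖(d v)⁻¹‖ + ‖n u‖ * ‖d v - d u‖ * (‖(d v)⁻¹‖ * ‖(d u)⁻¹‖)
      ≤ Ln * ‖v - u‖ * (2 / m) + B * (Ld * ‖v - u‖) * (2 / m * (1 / m)) := by
        gcongr
        exact hB u (hT1 hu)
    _ = _ := by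
        field_simp

noncomputable section

variable {N : ℕ}

/-- The truncated normalized amplitudes for the partition `S₀ ∪ {k} ∪ P`. -/
def truncAmp (S₀ P : Finset (Fin N)) (k : Fin N) : Set ((Fin N → ℂ) × (Fin N → ℂ)) :=
  {u | (∀ i ∈ S₀, u.1 i = 0 ∧ ‖u.2 i‖ = 1) ∧ (∀ i ∈ P, u.2 i = 0 ∧ ‖u.1 i‖ = 1) ∧
    max ‖u.1 k‖ ‖u.2 k‖ = 1}

theorem truncAmp_subset {S₀ P : Finset (Fin N)} {k : Fin N} (hu : ∀ i, i ∈ S₀ ∨ i = k ∨ i ∈ P) :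
    truncAmp S₀ P k ⊆ Metric.closedBall 0 1 := by
  rintro u ⟨h1, h2, h3⟩
  rw [mem_closedBall_zero_iff, Prod.norm_def]
  refine max_le ((pi_norm_le_iff_of_nonneg zero_le_one).2 fun i => ?_)
    ((pi_norm_le_iff_of_nonneg zero_le_one).2 fun i => ?_)
  · rcases hu i with hi | rfl | hi
    · simp [(h1 i hi).1]
    · exact (le_max_left _ _).trans h3.le
    · exact (h2 i hi).2.le
  · rcases hu i with hi | rfl | hi
    · exact (h1 i hi).2.le
    · exact (le_max_right _ _).trans h3.le
    · simp [(h2 i hi).1]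

theorem isCompact_truncAmp {S₀ P : Finset (Fin N)} {k : Fin N}
    (hu : ∀ i, i ∈ S₀ ∨ i = k ∨ i ∈ P) : IsCompact (truncAmp S₀ P k) := by
  refine (isCompact_closedBall 0 1).of_isClosed_subset ?_ (truncAmp_subset hu)
  simp only [truncAmp, Set.ofPred_and, Set.ofPred_forall]
  refine IsClosed.inter (isClosed_iInter fun i => isClosed_iInter fun _ =>
    (isClosed_eq (by fun_prop) (by fun_prop)).inter (isClosed_eq (by fun_prop) (by fun_prop)))
    (IsClosed.inter (isClosed_iInter fun i => isClosed_iInter fun _ =>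
    (isClosed_eq (by fun_prop) (by fun_prop)).inter (isClosed_eq (by fun_prop) (by fun_prop)))
    (isClosed_eq (by fun_prop) (by fun_prop)))

theorem contDiff_conj_comp {E : Type*} [NormedAddCommGroup E] [NormedSpace ℝ E] {f : E → ℂ}
    (hf : ContDiff ℝ 1 f) : ContDiff ℝ 1 fun x => conj (f x) :=
  Complex.conjCLE.contDiff.comp hf

theorem contDiff_ampMat_apply (σ : ℝ) (lam : Fin N → ℂ) (c : Fin N → Fin 2 → ℂ) (i j : Fin N) :
    ContDiff ℝ 1 fun u : (Fin N → ℂ) × (Fin N → ℂ) => ampMat σ lam c u.1 u.2 i j := by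
  have h1 : ∀ i, ContDiff ℝ 1 fun u : (Fin N → ℂ) × (Fin N → ℂ) => u.1 i := by
    intro i
    fun_prop
  have h2 : ∀ i, ContDiff ℝ 1 fun u : (Fin N → ℂ) × (Fin N → ℂ) => u.2 i := by
    intro i
    fun_prop
  simp only [ampMat, Matrix.of_apply]
  exact (contDiff_const.mul ((contDiff_conj_comp (h1 i)).mul (h1 j))).add
    (contDiff_const.mul ((contDiff_conj_comp (h2 i)).mul (h2 j)))

theorem contDiff_ampBorder_apply (σ : ℝ) (lam : Fin N → ℂ) (c : Fin N → Fin 2 → ℂ) (s : Fin 2)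
    (i j : Fin N ⊕ Unit) :
    ContDiff ℝ 1 fun u : (Fin N → ℂ) × (Fin N → ℂ) => ampBorder σ lam c s u.1 u.2 i j := by
  rcases i with i | i <;> rcases j with j | j
  · exact contDiff_ampMat_apply σ lam c i j
  · have h : ContDiff ℝ 1 fun u : (Fin N → ℂ) × (Fin N → ℂ) => u.1 i := by fun_prop
    exact contDiff_conj_comp h
  · have h : ContDiff ℝ 1 fun u : (Fin N → ℂ) × (Fin N → ℂ) => u.2 j := by fun_prop
    exact contDiff_const.mul h
  · exact contDiff_const

theorem ampMat_exp (σ : ℝ) (lam : Fin N → ℂ) (c : Fin N → Fin 2 → ℂ) (r : Fin N → ℝ) (x t : ℝ)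
    (i j : Fin N) :
    ampMat σ lam c (fun i => Complex.exp (theta lam i x t) * r i)
        (fun i => Complex.exp (-theta lam i x t) * r i) i j
      = r i * (r j * matM σ lam c x t i j) := by
  simp only [ampMat, matM, alphaEntry, cauchyEntry_eq, Matrix.of_apply, map_mul,
    Complex.conj_ofReal, ← Complex.exp_conj, map_neg, Complex.exp_add, sub_eq_add_neg]
  ring

theorem det_ampMat_exp (σ : ℝ) (lam : Fin N → ℂ) (c : Fin N → Fin 2 → ℂ) (r : Fin N → ℝ)
    (x t : ℝ) :
    (ampMat σ lam c (fun i => Complex.exp (theta lam i x t) * r i)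
        (fun i => Complex.exp (-theta lam i x t) * r i)).det
      = (∏ i, (r i : ℂ)) * ((∏ i, (r i : ℂ)) * (matM σ lam c x t).det) := by
  rw [← Matrix.det_mul_row, ← Matrix.det_mul_column]
  congr 1
  ext i j
  exact ampMat_exp σ lam c r x t i j

theorem det_ampBorder_exp (σ : ℝ) (lam : Fin N → ℂ) (c : Fin N → Fin 2 → ℂ) (s : Fin 2)
    (r : Fin N → ℝ) (x t : ℝ) :
    (ampBorder σ lam c s (fun i => Complex.exp (theta lam i x t) * r i)
        (fun i => Complex.exp (-theta lam i x t) * r i)).det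
      = (∏ i, (r i : ℂ)) * ((∏ i, (r i : ℂ)) *
        (Matrix.fromBlocks (matM σ lam c x t) (rowY1 lam x t).conjTranspose
          (rowY2 lam c s x t) (0 : Matrix Unit Unit ℂ)).det) := by
  have h : ∏ i, (r i : ℂ) = ∏ i : Fin N ⊕ Unit, Sum.elim (fun i => (r i : ℂ)) (fun _ => 1) i := by
    simp
  rw [h, ← Matrix.det_mul_row, ← Matrix.det_mul_column]
  congr 1
  ext i j
  rcases i with i | i <;> rcases j with j | j
  · simpa [ampBorder] using ampMat_exp σ lam c r x t i j
  · simp [ampBorder, rowY1, ← Complex.exp_conj]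
    ring
  · simp [ampBorder, rowY2]
    ring
  · simp [ampBorder]

/-- Both determinants acquire the factor `(∏ r_i)²`, which cancels. Real weights are needed because
conjugation acts on the rows. -/
theorem brightSoliton_eq_amp (σ : ℝ) (lam : Fin N → ℂ) (c : Fin N → Fin 2 → ℂ) (s : Fin 2)
    {r : Fin N → ℝ} (hr : ∀ i, r i ≠ 0) (x t : ℝ) :
    brightSoliton σ lam c s x t
      = -2 * ((ampBorder σ lam c s (fun i => Complex.exp (theta lam i x t) * r i)
            (fun i => Complex.exp (-theta lam i x t) * r i)).det
          / (ampMat σ lam c (fun i => Complex.exp (theta lam i x t) * r i)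
            (fun i => Complex.exp (-theta lam i x t) * r i)).det) := by
  have h : ∏ i, (r i : ℂ) ≠ 0 :=
    Finset.prod_ne_zero_iff.2 fun i _ => Complex.ofReal_ne_zero.2 (hr i)
  rw [det_ampMat_exp, det_ampBorder_exp, mul_div_mul_left _ _ h, mul_div_mul_left _ _ h]
  rfl

/-- Near the trajectory of the `k`-th particle the `N`-soliton is the `k`-th single soliton. -/
theorem exists_norm_brightSoliton_sub_le {σ : ℝ} {lam : Fin N → ℂ} {c : Fin N → Fin 2 → ℂ}
    (hz : ∀ i, (zpar lam i).im < 0) (hv : Function.Injective (vel lam))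
    {S₀ P : Finset (Fin N)} {k : Fin N} (hk₀ : k ∉ S₀) (hkP : k ∉ P) (hd : Disjoint S₀ P)
    (hu : ∀ i, i ∈ S₀ ∨ i = k ∨ i ∈ P)
    (hS₀ : (cauchyMat σ lam c S₀).det ≠ 0) (hS : (cauchyMat σ lam c (insert k S₀)).det ≠ 0) :
    ∃ ε₀ > 0, ∃ K ≥ 0, ∀ ε, 0 ≤ ε → ε ≤ ε₀ → ∀ x t : ℝ,
      (∀ i ∈ S₀, (theta lam i x t).re ≤ 0 ∧ Real.exp (-2 * |(theta lam i x t).re|) ≤ ε) →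
      (∀ i ∈ P, 0 ≤ (theta lam i x t).re ∧ Real.exp (-2 * |(theta lam i x t).re|) ≤ ε) →
      (matM σ lam c x t).det ≠ 0 ∧ ∀ s,
        ‖brightSoliton σ lam c s x t - partSoliton σ lam c s (insert k S₀) S₀ P k x t‖ ≤ K * ε := by
  have htr := fun (u : (Fin N → ℂ) × (Fin N → ℂ)) (h : u ∈ truncAmp S₀ P k) =>
    ampMat_truncated (p := u.1) (q := u.2) hz hv hk₀ hkP hd hu hS₀ hS (fun i hi => (h.1 i hi).1)
      (fun i hi => (h.2.1 i hi).1)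
      (fun i hi h0 => by simpa [h0] using (h.2.1 i hi).2)
      (fun i hi h0 => by simpa [h0] using (h.1 i hi).2)
      (by
        by_contra! h0
        simpa [h0.1, h0.2] using h.2.2)
  have hL := fun s => exists_norm_div_sub_div_le
    (contDiff_det (contDiff_ampBorder_apply σ lam c s)) (contDiff_det (contDiff_ampMat_apply σ lam c))
    (isCompact_truncAmp hu) (truncAmp_subset hu) fun u h => (htr u h).1
  choose ε₀ hε₀ K hK hL using hL
  refine ⟨min (ε₀ 0) (ε₀ 1), lt_min (hε₀ 0) (hε₀ 1), 2 * (K 0 + K 1), ?_, ?_⟩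
  · have := hK 0
    have := hK 1
    positivity
  intro ε hε hεε x t hxS hxP
  -- This weight gives the larger of `‖p i‖`, `‖q i‖` the value `1` and the smaller the value
  -- `e^{-2|Re θ_i|}`.
  set r : Fin N → ℝ := fun i => Real.exp (-|(theta lam i x t).re|) with hr
  have hr0 : ∀ i, r i ≠ 0 := fun i => (Real.exp_pos _).ne'
  set p : Fin N → ℂ := fun i => Complex.exp (theta lam i x t) * r i with hp
  set q : Fin N → ℂ := fun i => Complex.exp (-theta lam i x t) * r i with hq
  have hnp : ∀ i, ‖p i‖ = Real.exp ((theta lam i x t).re - |(theta lam i x t).re|) := by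
    intro i
    simp [hp, hr, Complex.norm_exp, Real.exp_add, sub_eq_add_neg]
  have hnq : ∀ i, ‖q i‖ = Real.exp (-(theta lam i x t).re - |(theta lam i x t).re|) := by
    intro i
    simp [hq, hr, Complex.norm_exp, Real.exp_add, sub_eq_add_neg]
  have hp_pos : ∀ i, 0 ≤ (theta lam i x t).re →
      ‖p i‖ = 1 ∧ ‖q i‖ = Real.exp (-2 * |(theta lam i x t).re|) := by
    intro i hi
    rw [hnp, hnq, abs_of_nonneg hi, sub_self, Real.exp_zero]
    exact ⟨rfl, by ring_nf⟩
  have hp_neg : ∀ i, (theta lam i x t).re ≤ 0 →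
      ‖q i‖ = 1 ∧ ‖p i‖ = Real.exp (-2 * |(theta lam i x t).re|) := by
    intro i hi
    rw [hnp, hnq, abs_of_nonpos hi, sub_self, Real.exp_zero]
    exact ⟨rfl, by ring_nf⟩
  have hp1 : ∀ i, ‖p i‖ ≤ 1 := fun i => by
    rw [hnp, Real.exp_le_one_iff]
    linarith [le_abs_self (theta lam i x t).re]
  have hq1 : ∀ i, ‖q i‖ ≤ 1 := fun i => by
    rw [hnq, Real.exp_le_one_iff]
    linarith [neg_le_abs (theta lam i x t).re]
  -- Only the small amplitudes are dropped and index `k` stays untouched, so the truncated point is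
  -- within `ε`.
  set p₀ : Fin N → ℂ := fun i => if i ∈ S₀ then 0 else p i with hp₀
  set q₀ : Fin N → ℂ := fun i => if i ∈ P then 0 else q i with hq₀
  have hP0 : ∀ i ∈ P, i ∉ S₀ := fun i hi h => Finset.disjoint_left.1 hd h hi
  have hp₀k : p₀ k = p k := if_neg hk₀
  have hq₀k : q₀ k = q k := if_neg hkP
  have hmem : (p₀, q₀) ∈ truncAmp S₀ P k := by
    refine ⟨fun i hi => ⟨if_pos hi, ?_⟩, fun i hi => ⟨if_pos hi, ?_⟩, ?_⟩
    · simp only [hq₀, if_neg (Finset.disjoint_left.1 hd hi)]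
      exact (hp_neg i (hxS i hi).1).1
    · simp only [hp₀, if_neg (hP0 i hi)]
      exact (hp_pos i (hxP i hi).1).1
    · change max ‖p₀ k‖ ‖q₀ k‖ = 1
      rw [hp₀k, hq₀k]
      rcases le_total 0 (theta lam k x t).re with h | h
      · rw [(hp_pos k h).1, max_eq_left (hq1 k)]
      · rw [(hp_neg k h).1, max_eq_right (hp1 k)]
  have hv1 : ‖(p, q)‖ ≤ 1 := by
    rw [Prod.norm_def]
    exact max_le ((pi_norm_le_iff_of_nonneg zero_le_one).2 hp1)
      ((pi_norm_le_iff_of_nonneg zero_le_one).2 hq1)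
  have hdist : ‖(p, q) - (p₀, q₀)‖ ≤ ε := by
    rw [Prod.norm_def]
    refine max_le ((pi_norm_le_iff_of_nonneg hε).2 fun i => ?_)
      ((pi_norm_le_iff_of_nonneg hε).2 fun i => ?_)
    · change ‖p i - p₀ i‖ ≤ ε
      by_cases hi : i ∈ S₀
      · simp only [hp₀, if_pos hi, sub_zero]
        rw [(hp_neg i (hxS i hi).1).2]
        exact (hxS i hi).2
      · simpa [hp₀, hi] using hε
    · change ‖q i - q₀ i‖ ≤ ε
      by_cases hi : i ∈ P
      · simp only [hq₀, if_pos hi, sub_zero]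
        rw [(hp_pos i (hxP i hi).1).2]
        exact (hxP i hi).2
      · simpa [hq₀, hi] using hε
  have key := fun s => hL s (p₀, q₀) hmem (p, q) hv1 (hdist.trans (hεε.trans (by
    fin_cases s
    · exact min_le_left _ _
    · exact min_le_right _ _)))
  refine ⟨fun h0 => (key 0).1 ?_, fun s => ?_⟩
  · have := det_ampMat_exp σ lam c r x t
    rwa [h0, mul_zero, mul_zero] at this
  · rw [brightSoliton_eq_amp σ lam c s hr0, partSoliton_eq_amp hz hv s hkP x t (r k) (hr0 k)]
    have h1 := (htr _ hmem).2 s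
    simp only [hp₀k, hq₀k] at h1
    change ‖-2 * ((ampBorder σ lam c s p q).det / (ampMat σ lam c p q).det) -
      cHat σ lam c s (insert k S₀) S₀ P k * zfac lam k *
        (q k * conj (p k) * conj (shiftFactor lam P k)
          / ampDenom σ lam c (insert k S₀) S₀ P k (p k) (q k))‖ ≤ _
    rw [← h1, ← mul_sub, norm_mul, norm_neg, Complex.norm_ofNat, mul_assoc]
    refine mul_le_mul_of_nonneg_left ?_ zero_le_two
    refine ((key s).2.trans (mul_le_mul_of_nonneg_left hdist (hK s))).trans
      (mul_le_mul_of_nonneg_right ?_ hε)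
    have := hK 0
    have := hK 1
    fin_cases s
    · simpa
    · simpa

/-! ### Separation of the trajectories and global asymptotics -/

theorem theta_re {lam : Fin N → ℂ} (hz : ∀ i, (zpar lam i).im < 0) (i : Fin N) (x t : ℝ) :
    (theta lam i x t).re = -(zpar lam i).im * (x - vel lam i * t) := by
  have h0 := zpar_ne_zero hz i
  have h1 : ((t : ℂ) / (4 * zpar lam i)).im = -(zpar lam i).im * t / (4 * ‖zpar lam i‖ ^ 2) := by
    have h2 : (t : ℂ) / (4 * zpar lam i) = ((t / 4 : ℝ) : ℂ) * (zpar lam i)⁻¹ := by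
      push_cast
      field_simp
    rw [h2, Complex.im_ofReal_mul, Complex.inv_im, Complex.normSq_eq_norm_sq]
    have := norm_ne_zero_iff.2 h0
    field_simp
  rw [theta, Complex.I_mul_re, Complex.add_im, h1, Complex.im_mul_ofReal, vel]
  ring

/-- Among points with mutual distance at least `D`, all but the one nearest to the origin are at
distance at least `D / 2` from the origin, on the side on which they lie of the nearest one. -/
theorem exists_separating_index [NeZero N] (y : Fin N → ℝ) (D : ℝ)
    (hD : ∀ i j, i ≠ j → D ≤ |y i - y j|) :
    ∃ k, ∀ i, i ≠ k → (y i < y k → y i ≤ 0) ∧ (y k < y i → 0 ≤ y i) ∧ D / 2 ≤ |y i| := by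
  obtain ⟨k, hk⟩ := Finite.exists_min fun i => |y i|
  refine ⟨k, fun i hi => ⟨fun h => ?_, fun h => ?_, ?_⟩⟩
  · by_contra! h0
    have := hk i
    rw [abs_of_pos h0, abs_of_pos (h0.trans h)] at this
    linarith
  · by_contra! h0
    have := hk i
    rw [abs_of_neg h0, abs_of_neg (h.trans h0)] at this
    linarith
  -- As `k` is nearest to the origin, `D ≤ |y i| + |y k| ≤ 2 |y i|`.
  · have h1 := abs_sub (y i) (y k)
    linarith [hD i k hi, hk i]

theorem decayRate_pos {lam : Fin N → ℂ} (hz : ∀ i, (zpar lam i).im < 0)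
    (hv : Function.Injective (vel lam)) (hN : 2 ≤ N) : 0 < decayRate lam := by
  have : Nonempty (Fin N) := ⟨⟨0, by omega⟩⟩
  have : Nonempty {p : Fin N × Fin N // p.1 ≠ p.2} :=
    ⟨⟨(⟨0, by omega⟩, ⟨1, by omega⟩), by simp⟩⟩
  refine mul_pos ?_ ?_
  · obtain ⟨i, hi⟩ := exists_eq_ciInf_of_finite (f := fun i => |(zpar lam i).im|)
    rw [← hi]
    exact abs_pos.2 (hz i).ne
  · obtain ⟨p, hp⟩ := exists_eq_ciInf_of_finite
      (f := fun p : {p : Fin N × Fin N // p.1 ≠ p.2} => |vel lam p.1.1 - vel lam p.1.2|)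
    rw [← hp]
    exact abs_pos.2 (sub_ne_zero.2 fun h => p.2 (hv h))

/-- At each `x` one index `k` dominates and all the other amplitudes are within `e^{-c|t|}` of
their limits. -/
theorem exists_dominant_index [NeZero N] {lam : Fin N → ℂ} (hz : ∀ i, (zpar lam i).im < 0)
    (x t : ℝ) :
    ∃ k, ∀ i, i ≠ k →
      (x - vel lam i * t < x - vel lam k * t → (theta lam i x t).re ≤ 0) ∧
      (x - vel lam k * t < x - vel lam i * t → 0 ≤ (theta lam i x t).re) ∧
      Real.exp (-2 * |(theta lam i x t).re|) ≤ Real.exp (-decayRate lam * |t|) := by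
  set a := ⨅ i : Fin N, |(zpar lam i).im| with ha
  set d := ⨅ p : {p : Fin N × Fin N // p.1 ≠ p.2}, |vel lam p.1.1 - vel lam p.1.2| with hd
  obtain ⟨k, hk⟩ := exists_separating_index (fun i => x - vel lam i * t) (d * |t|)
    (fun i j hij => by
      have h : d ≤ |vel lam i - vel lam j| :=
        ciInf_le (f := fun p : {p : Fin N × Fin N // p.1 ≠ p.2} =>
          |vel lam p.1.1 - vel lam p.1.2|) (Set.finite_range _).bddBelow ⟨(i, j), hij⟩
      have e : x - vel lam i * t - (x - vel lam j * t) = -((vel lam i - vel lam j) * t) := by ring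
      rw [e, abs_neg, abs_mul]
      exact mul_le_mul_of_nonneg_right h (abs_nonneg t))
  refine ⟨k, fun i hi => ?_⟩
  obtain ⟨h1, h2, h3⟩ := hk i hi
  have hzi := hz i
  simp only [theta_re hz]
  refine ⟨fun h => ?_, fun h => ?_, ?_⟩
  · exact mul_nonpos_of_nonneg_of_nonpos (by linarith) (h1 h)
  · exact mul_nonneg (by linarith) (h2 h)
  -- The factor `2` in the exponent cancels the half-distance, which yields the rate `a * d`
  -- exactly.
  · rw [Real.exp_le_exp, abs_mul, abs_neg]
    have h4 : a ≤ |(zpar lam i).im| := ciInf_le (Set.finite_range _).bddBelow i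
    have h5 : 0 ≤ d * |t| / 2 :=
      div_nonneg (mul_nonneg (Real.iInf_nonneg fun _ => abs_nonneg _) (abs_nonneg _)) zero_le_two
    have h6 := mul_le_mul h4 h3 h5 (abs_nonneg _)
    have h7 : decayRate lam = a * d := rfl
    rw [h7]
    linarith

/-- Treats both time directions at once: they differ only in which indices lie on each side of `k`,
and `hord` records this. The dominant `k` varies with `x`, but finitely many constants suffice. -/
theorem exists_asymptotics {σ : ℝ} {lam : Fin N → ℂ} {c : Fin N → Fin 2 → ℂ}
    (hz : ∀ i, (zpar lam i).im < 0) (hv : Function.Injective (vel lam))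
    (r : ℝ) (hr : 2 ≤ N → r = decayRate lam) {S₀ P : Fin N → Finset (Fin N)}
    (hk₀ : ∀ k, k ∉ S₀ k) (hkP : ∀ k, k ∉ P k) (hd : ∀ k, Disjoint (S₀ k) (P k))
    (hu : ∀ k i, i ∈ S₀ k ∨ i = k ∨ i ∈ P k)
    (hS₀ : ∀ k, (cauchyMat σ lam c (S₀ k)).det ≠ 0)
    (hS : ∀ k, (cauchyMat σ lam c (insert k (S₀ k))).det ≠ 0) {l : Filter ℝ}
    (hl : Tendsto (fun t : ℝ => |t|) l atTop)
    (hord : ∀ᶠ t in l, ∀ k, (∀ i ∈ S₀ k, vel lam k * t < vel lam i * t) ∧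
      ∀ i ∈ P k, vel lam i * t < vel lam k * t) :
    ∃ K : ℝ, ∀ᶠ t in l, ∀ x : ℝ, (matM σ lam c x t).det ≠ 0 ∧ ∀ s : Fin 2,
      ‖brightSoliton σ lam c s x t
          - ∑ k, partSoliton σ lam c s (insert k (S₀ k)) (S₀ k) (P k) k x t‖
        ≤ K * Real.exp (-r * |t|) := by
  -- With no particles the bordered matrix is the `1 × 1` zero matrix, so both sides vanish.
  rcases Nat.eq_zero_or_pos N with rfl | hN
  · refine ⟨0, Eventually.of_forall fun t x => ⟨by simp, fun s => ?_⟩⟩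
    have : (Matrix.fromBlocks (matM σ lam c x t) (rowY1 lam x t).conjTranspose
        (rowY2 lam c s x t) (0 : Matrix Unit Unit ℂ)).det = 0 :=
      Matrix.det_eq_zero_of_column_eq_zero (Sum.inr ()) (by
        rintro (i | i)
        · exact i.elim0
        · rfl)
    simp [brightSoliton, this]
  have : NeZero N := ⟨hN.ne'⟩
  choose ε₀ hε₀ K hK hmain using fun k =>
    exists_norm_brightSoliton_sub_le hz hv (hk₀ k) (hkP k) (hd k) (hu k) (hS₀ k) (hS k)
  choose L hL hsol using fun (s : Fin 2) k =>
    exists_norm_partSoliton_le hz hv s (hk₀ k) (hkP k) (hS₀ k) (hS k)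
  have hK' : 0 ≤ ∑ k, K k := Finset.sum_nonneg fun k _ => hK k
  have hL' : ∀ s, 0 ≤ ∑ k, L s k := fun s => Finset.sum_nonneg fun k _ => hL s k
  -- For `N = 1` the rate `r` is arbitrary and `e^{-r|t|}` need not tend to zero. No index differs
  -- from `k` then, so the error `0` is available.
  set ε : ℝ → ℝ := fun t => if 2 ≤ N then Real.exp (-r * |t|) else 0 with hε
  have hε0 : ∀ t, 0 ≤ ε t := fun t => by
    simp only [hε]
    split_ifs
    exacts [(Real.exp_pos _).le, le_rfl]
  have hεr : ∀ t, ε t ≤ Real.exp (-r * |t|) := fun t => by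
    simp only [hε]
    split_ifs
    exacts [le_rfl, (Real.exp_pos _).le]
  have hεt : Tendsto ε l (nhds 0) := by
    by_cases h2 : 2 ≤ N
    · simp only [hε, if_pos h2]
      have hr0 : 0 < r := by
        rw [hr h2]
        exact decayRate_pos hz hv h2
      exact Real.tendsto_exp_atBot.comp (hl.const_mul_atTop_of_neg (neg_neg_of_pos hr0))
    · simpa only [hε, if_neg h2] using tendsto_const_nhds
  have hεe : ∀ᶠ t in l, ∀ k, ε t ≤ ε₀ k :=
    eventually_all.2 fun k => (hεt.eventually_lt_const (hε₀ k)).mono fun _ h => h.le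
  refine ⟨∑ k, K k + ∑ s, ∑ k, L s k, ?_⟩
  filter_upwards [hord, hεe] with t ht hεk x
  obtain ⟨k, hk⟩ := exists_dominant_index hz x t
  have hsmall : ∀ i, i ≠ k → Real.exp (-2 * |(theta lam i x t).re|) ≤ ε t := by
    intro i hi
    have h2 : 2 ≤ N := by
      by_contra h
      exact hi (Fin.ext (by omega))
    simp only [hε, if_pos h2, hr h2]
    exact (hk i hi).2.2
  obtain ⟨h1, h2⟩ := hmain k (ε t) (hε0 t) (hεk k) x t
    (fun i hi => by
      have hik : i ≠ k := fun h => hk₀ k (h ▸ hi)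
      exact ⟨(hk i hik).1 (by linarith [(ht k).1 i hi]), hsmall i hik⟩)
    (fun i hi => by
      have hik : i ≠ k := fun h => hkP k (h ▸ hi)
      exact ⟨(hk i hik).2.1 (by linarith [(ht k).2 i hi]), hsmall i hik⟩)
  refine ⟨h1, fun s => ?_⟩
  rw [← Finset.add_sum_erase _ _ (Finset.mem_univ k), ← sub_sub]
  have h3 : ‖∑ i ∈ Finset.univ.erase k,
      partSoliton σ lam c s (insert i (S₀ i)) (S₀ i) (P i) i x t‖ ≤ (∑ i, L s i) * ε t := by
    refine (norm_sum_le _ _).trans ?_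
    rw [Finset.sum_mul]
    refine (Finset.sum_le_sum fun i hi => ?_).trans
      (Finset.sum_le_sum_of_subset_of_nonneg (Finset.erase_subset k _)
        fun i _ _ => mul_nonneg (hL s i) (hε0 t))
    exact (hsol s i x t).trans
      (mul_le_mul_of_nonneg_left (hsmall i (Finset.ne_of_mem_erase hi)) (hL s i))
  refine (norm_sub_le _ _).trans ((add_le_add (h2 s) h3).trans ?_)
  rw [← add_mul]
  refine mul_le_mul (add_le_add ?_ ?_) (hεr t) (hε0 t) ?_
  · exact Finset.single_le_sum (f := K) (fun i _ => hK i) (Finset.mem_univ k)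
  · exact Finset.single_le_sum (f := fun s => ∑ k, L s k) (fun s _ => hL' s) (Finset.mem_univ s)
  · exact add_nonneg hK' (Finset.sum_nonneg fun s _ => hL' s)

theorem det_cauchyMat_empty (σ : ℝ) (lam : Fin N → ℂ) (c : Fin N → Fin 2 → ℂ) :
    (cauchyMat σ lam c ∅).det = 1 := Matrix.det_isEmpty

end

end CoupledFL

/-! ### The two time limits -/

theorem mainTheorem1 {N : ℕ} (σ : ℝ) (hσ : σ = 1 ∨ σ = -1)
    (lam : Fin N → ℂ) (c : Fin N → Fin 2 → ℂ)
    (hz : ∀ i, (CoupledFL.zpar lam i).im < 0)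
    (hv : StrictMono (CoupledFL.vel lam))
    (hc : ∀ i, c i ≠ 0)
    (r : ℝ) (hr : 2 ≤ N → r = CoupledFL.decayRate lam) :
    ((σ = -1 → ∀ k, (CoupledFL.cauchyMat σ lam c (Finset.Iic k)).det ≠ 0) →
      (∀ k, (CoupledFL.cauchyMat σ lam c (Finset.Iio k)).det ≠ 0 ∧
        ∀ x t : ℝ, CoupledFL.denomMinus σ lam c k x t ≠ 0) ∧
      ∃ K : ℝ, ∀ᶠ t : ℝ in atBot, ∀ x : ℝ, (CoupledFL.matM σ lam c x t).det ≠ 0 ∧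
        ∀ s : Fin 2,
          ‖CoupledFL.brightSoliton σ lam c s x t
              - ∑ k : Fin N, CoupledFL.solitonMinus σ lam c s k x t‖
            ≤ K * Real.exp (-r * |t|)) ∧
    ((σ = -1 → ∀ k, (CoupledFL.cauchyMat σ lam c (Finset.Ici k)).det ≠ 0) →
      (∀ k, (CoupledFL.cauchyMat σ lam c (Finset.Ioi k)).det ≠ 0 ∧
        ∀ x t : ℝ, CoupledFL.denomPlus σ lam c k x t ≠ 0) ∧
      ∃ K : ℝ, ∀ᶠ t : ℝ in atTop, ∀ x : ℝ, (CoupledFL.matM σ lam c x t).det ≠ 0 ∧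
        ∀ s : Fin 2,
          ‖CoupledFL.brightSoliton σ lam c s x t
              - ∑ k : Fin N, CoupledFL.solitonPlus σ lam c s k x t‖
            ≤ K * Real.exp (-r * |t|)) := by
  open CoupledFL in
  have hvi : Function.Injective (vel lam) := hv.injective
  have hone : σ = 1 → ∀ S, (cauchyMat σ lam c S).det ≠ 0 := by
    rintro rfl S
    exact det_cauchyMat_ne_zero_of_one hz hvi hc S
  refine ⟨fun h => ?_, fun h => ?_⟩
  · have hIic : ∀ k, (cauchyMat σ lam c (Finset.Iic k)).det ≠ 0 := fun k =>
      hσ.elim (fun e => hone e _) fun e => h e k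
    -- `Iio k` is either empty, with determinant `1`, or the previous `Iic`.
    have hIio : ∀ k, (cauchyMat σ lam c (Finset.Iio k)).det ≠ 0 := by
      intro k
      rcases Nat.eq_zero_or_pos k.val with h0 | h0
      · have e : Finset.Iio k = ∅ := by
          ext i
          simp [Fin.lt_def, h0]
        rw [e, det_cauchyMat_empty]
        exact one_ne_zero
      · have e : Finset.Iio k = Finset.Iic ⟨k - 1, by omega⟩ := by
          ext i
          simp only [Finset.mem_Iio, Finset.mem_Iic, Fin.lt_def, Fin.le_def]
          omega
        rw [e]
        exact hIic _
    have hins : ∀ k : Fin N, insert k (Finset.Iio k) = Finset.Iic k := fun k =>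
      Finset.Iio_insert k
    refine ⟨fun k => ⟨hIio k, fun x t => ?_⟩, ?_⟩
    · have := solDenom_ne_zero (σ := σ) (c := c) hz hvi (S₀ := Finset.Iio k) (P := Finset.Ioi k)
        (k := k) (by simp) (by simp) x t
      rwa [hins] at this
    · have := exists_asymptotics hz hvi r hr (S₀ := fun k => Finset.Iio k)
        (P := fun k => Finset.Ioi k) (by simp) (by simp)
        (fun k => Finset.disjoint_left.2 fun i hi hi' =>
          (Finset.mem_Iio.1 hi).not_gt (Finset.mem_Ioi.1 hi'))
        (fun k i => by simpa using lt_trichotomy i k) hIio (fun k => by rw [hins]; exact hIic k)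
        tendsto_abs_atBot_atTop
        -- Negative time reverses the order of the products `v_i t`, so the slower particles form
        -- `S₀` here and the faster ones do in the other limit.
        ((eventually_lt_atBot 0).mono fun t ht k =>
          ⟨fun i hi => mul_lt_mul_of_neg_right (hv (Finset.mem_Iio.1 hi)) ht,
            fun i hi => mul_lt_mul_of_neg_right (hv (Finset.mem_Ioi.1 hi)) ht⟩)
      simp only [hins] at this
      exact this
  · have hIci : ∀ k, (cauchyMat σ lam c (Finset.Ici k)).det ≠ 0 := fun k =>
      hσ.elim (fun e => hone e _) fun e => h e k
    have hIoi : ∀ k, (cauchyMat σ lam c (Finset.Ioi k)).det ≠ 0 := by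
      intro k
      by_cases h0 : k.val + 1 < N
      · have e : Finset.Ioi k = Finset.Ici ⟨k + 1, h0⟩ := by
          ext i
          simp only [Finset.mem_Ioi, Finset.mem_Ici, Fin.lt_def, Fin.le_def]
          omega
        rw [e]
        exact hIci _
      · have e : Finset.Ioi k = ∅ := by
          ext i
          simp only [Finset.mem_Ioi, Fin.lt_def, Finset.notMem_empty, iff_false]
          omega
        rw [e, det_cauchyMat_empty]
        exact one_ne_zero
    have hins : ∀ k : Fin N, insert k (Finset.Ioi k) = Finset.Ici k := fun k =>
      Finset.Ioi_insert k
    refine ⟨fun k => ⟨hIoi k, fun x t => ?_⟩, ?_⟩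
    · have := solDenom_ne_zero (σ := σ) (c := c) hz hvi (S₀ := Finset.Ioi k) (P := Finset.Iio k)
        (k := k) (by simp) (by simp) x t
      rwa [hins] at this
    · have := exists_asymptotics hz hvi r hr (S₀ := fun k => Finset.Ioi k)
        (P := fun k => Finset.Iio k) (by simp) (by simp)
        (fun k => Finset.disjoint_left.2 fun i hi hi' =>
          (Finset.mem_Ioi.1 hi).not_gt (Finset.mem_Iio.1 hi'))
        (fun k i => by
          have := lt_trichotomy k i
          simp only [Finset.mem_Ioi, Finset.mem_Iio]
          tauto) hIoi (fun k => by rw [hins]; exact hIci k)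
        tendsto_abs_atTop_atTop
        ((eventually_gt_atTop 0).mono fun t ht k =>
          ⟨fun i hi => mul_lt_mul_of_pos_right (hv (Finset.mem_Ioi.1 hi)) ht,
            fun i hi => mul_lt_mul_of_pos_right (hv (Finset.mem_Iio.1 hi)) ht⟩)
      simp only [hins] at this
      exact this
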